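/- Consider the square lattice $\mathbb{Z}^2$ with a spin-$\tfrac12$ at every bond, let $\mathbf{B}$ be the set of bonds, and let $\mathfrak{A}$ be the quasi-local $C^*$-algebra, i.e. the norm completion of $\bigcup_{\Lambda}\bigotimes_{b\in\Lambda}M_2(\mathbb{C})$ over the finite sets $\Lambda\subset\mathbf{B}$. For $\Lambda\subset\mathbf{B}$ let $\mathfrak{A}(\Lambda)\subset\mathfrak{A}$ be the $C^*$-subalgebra generated by the observables at the bonds of $\Lambda$. For a vertex $s$ let $A_s$ be the product of $\sigma^x$ over the four bonds that end at $s$, and for a plaquette $p$ let $B_p$ be the product of $\sigma^z$ over the four bonds that enclose $p$. Let $\omega_0$ be the (frustration-free) ground state of the toric code, i.e. the unique state of $\mathfrak{A}$ with $\omega_0(A_s)=\omega_0(B_p)=1$ for all $s$ and $p$. A site of type $Z$ is a vertex, a site of type $X$ is a plaquette, and a site of type $Y$ is a pair consisting of a plaquette and one of its corners. For $k\in\{X,Y,Z\}$, a path of type $k$ from a site $x$ to infinity is a sequence of sites of type $k$ that starts at $x$, leaves every finite set, and in which consecutive sites are neighbours: neighbouring vertices for $k=Z$ (the step contributes $\sigma^z$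 at the bond joining them), neighbouring plaquettes for $k=X$ (the step contributes $\sigma^x$ at the bond separating them), and for $k=Y$ either the vertex or the plaquette moves to a neighbour (contributing $\sigma^z$, respectively $\sigma^x$) while the other one stays fixed. Let $\Gamma_n$ be the product of the contributions of the first $n$ steps, let $\rho_\gamma(A)=\lim_{n\to\infty}\Gamma_nA\Gamma_n^*$ (norm limit) be the resulting endomorphism of $\mathfrak{A}$, and let $\omega_k^x=\omega_0\circ\rho_\gamma$, a state that depends only on $k$ and $x$, not on $\gamma$. Put $\omega_0^x=\omega_0$. Write $\pi_\omega$ for the GNS representation of a state $\omega$, $\pi_0=\pi_{\omega_0}$, and $\cong$ for unitary equivalence. A cone is a set of bonds of the following form: given two half-lines emanating from a common point of $\mathbb{Z}^2$ at an angle strictly between $0$ and $\pi$, it consists of all bonds that lie in the area bounded by the two half-lines or that meet one of them. Theorem. (i) For every cone $\Lambda\subset\mathbf{B}$, every $k\in\{X,Y,Z\}$ and every site $x$ of type $k$, $$\pi_0\upharpoonright\mathfrak{A}(\Lambda^c)\;\cong\;\pi_{\omega_k^x}\upharpoonright\mathfrak{A}(\Lambda^c).$$ (ii) For all $k,l\in\{0,X,Y,Z\}$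 and all sites $x$, $y$ of type $k$, respectively $l$ (arbitrary for type $0$), $\pi_{\omega_k^x}\cong\pi_{\omega_l^y}$ if and only if $k=l$. -/

import Mathlib

open scoped ComplexOrder ENNReal
open Filter Topology

namespace ToricCode

/-- The bonds of the square lattice `ℤ²`: `hor i j` joins `(i, j)` to `(i + 1, j)` and
`ver i j` joins `(i, j)` to `(i, j + 1)`. -/
inductive Bond : Type
  | hor (i j : ℤ) : Bond
  | ver (i j : ℤ) : Bond
  deriving DecidableEq

/-- The spin configurations that differ from the all-zero configuration at finitely many bonds. -/
abbrev Config : Type := Bond →₀ Fin 2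

/-- The Hilbert space `ℓ²(Config)`, that is the infinite tensor product of one copy of `ℂ²` for each
bond along the reference vector `⊗_b |0⟩`. The quasi-local algebra is realised on it. -/
abbrev Hilb : Type := lp (fun _ : Config => ℂ) 2

/-- Multiplication by the function `c ↦ g (c b)`. -/
noncomputable def diagOp (b : Bond) (g : Fin 2 → ℂ) : Hilb →L[ℂ] Hilb :=
  lp.mapCLM (K := ∑ j, ‖g j‖) 2 (fun c : Config => g (c b) • ContinuousLinearMap.id ℂ ℂ)
    (Finset.sum_nonneg fun j _ => norm_nonneg (g j))
    (fun c => by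
      refine (ContinuousLinearMap.opNorm_le_bound _ (norm_nonneg (g (c b))) fun x => ?_).trans
        (Finset.single_le_sum (f := fun j => ‖g j‖) (fun j _ => norm_nonneg _)
          (Finset.mem_univ (c b)))
      simp)

theorem diagOp_apply (b : Bond) (g : Fin 2 → ℂ) (ψ : Hilb) (c : Config) :
    diagOp b g ψ c = g (c b) * ψ c := by
  simp [diagOp]

/-- The configuration `c` with its value at `b` flipped. -/
noncomputable def flip (b : Bond) : Config ≃ Config :=
  Equiv.addRight (Finsupp.single b 1)

theorem flip_flip (b : Bond) (c : Config) : flip b (flip b c) = c := by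
  ext b'
  simp only [flip, Equiv.coe_addRight, Finsupp.add_apply, add_assoc]
  have : ∀ x : Fin 2, x + x = 0 := by decide
  simp [this]

/-- The unitary that flips the spin at `b`. -/
noncomputable def flipOp (b : Bond) : Hilb →L[ℂ] Hilb :=
  LinearMap.mkContinuous
    { toFun := fun ψ => ⟨fun c => ψ (flip b c), memℓp_gen (by
          exact (flip b).summable_iff.mpr ((lp.memℓp ψ).summable (by norm_num)))⟩
      map_add' := fun _ _ => rfl
      map_smul' := fun _ _ => rfl }
    1 (fun ψ => by
      rw [one_mul]
      refine lp.norm_le_of_tsum_le (by norm_num) (norm_nonneg _) ?_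
      rw [lp.norm_rpow_eq_tsum (by norm_num)]
      exact ((flip b).tsum_eq (fun c => ‖ψ c‖ ^ (2 : ℝ≥0∞).toReal)).le)

theorem flipOp_apply (b : Bond) (ψ : Hilb) (c : Config) : flipOp b ψ c = ψ (flip b c) := rfl

/-- The operator that acts as the matrix `m` on the tensor factor at `b`, see `siteOp_apply`. -/
noncomputable def siteOp (b : Bond) (m : Matrix (Fin 2) (Fin 2) ℂ) : Hilb →L[ℂ] Hilb :=
  diagOp b (fun j => m j j) + diagOp b (fun j => m j (j + 1)) ∘L flipOp b

theorem siteOp_apply' (b : Bond) (m : Matrix (Fin 2) (Fin 2) ℂ) (ψ : Hilb) (c : Config) :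
    siteOp b m ψ c = m (c b) (c b) * ψ c + m (c b) (c b + 1) * ψ (flip b c) := by
  simp [siteOp, diagOp_apply, flipOp_apply]

theorem siteOp_apply (b : Bond) (m : Matrix (Fin 2) (Fin 2) ℂ) (ψ : Hilb) (c : Config) :
    siteOp b m ψ c = ∑ j, m (c b) j * ψ (c.update b j) := by
  have h1 : c.update b (c b) = c := by simp
  have h2 : flip b c = c.update b (c b + 1) := by
    ext b'
    by_cases h : b' = b
    · subst h; simp [flip]
    · simp [flip, Finsupp.update_apply, h]
  rw [siteOp_apply', h2]
  conv_lhs => rw [← congrArg (fun x => ψ x) h1]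
  generalize c b = x
  fin_cases x
  · simp [Fin.sum_univ_two]
  · simp [Fin.sum_univ_two, add_comm]

theorem flip_same (b : Bond) (c : Config) : flip b c b = c b + 1 := by simp [flip]

theorem flip_ne {b b' : Bond} (h : b' ≠ b) (c : Config) : flip b c b' = c b' := by
  simp [flip, h.symm]

/-- The embedding of `M₂(ℂ)` as the algebra of observables of the spin at the bond `b`. -/
noncomputable def siteHom (b : Bond) : Matrix (Fin 2) (Fin 2) ℂ →⋆ₐ[ℂ] (Hilb →L[ℂ] Hilb) where
  toFun := siteOp b
  map_one' := by
    ext ψ c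
    have : ∀ x : Fin 2, x ≠ x + 1 := by decide
    simp [siteOp_apply', this]
  map_zero' := by
    ext ψ c
    simp [siteOp_apply']
  map_mul' m n := by
    ext ψ c
    have h : ∀ x : Fin 2, x + 1 + 1 = x := by decide
    simp only [siteOp_apply', mul_apply_eq_comp, flip_same, flip_flip, h,
      Matrix.mul_apply, Fin.sum_univ_two]
    generalize c b = x
    fin_cases x <;> simp <;> ring
  map_add' m n := by
    ext ψ c
    simp only [siteOp_apply', add_apply, lp.coeFn_add, Pi.add_apply,
      Matrix.add_apply]
    ring
  commutes' r := by
    ext ψ c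
    have : ∀ x : Fin 2, x ≠ x + 1 := by decide
    simp [siteOp_apply', this, Algebra.algebraMap_eq_smul_one]
  map_star' m := by
    rw [ContinuousLinearMap.star_eq_adjoint, ContinuousLinearMap.eq_adjoint_iff]
    intro φ ψ
    have e : ∀ (m : Matrix (Fin 2) (Fin 2) ℂ) (φ : Hilb), siteOp b m φ =
        diagOp b (fun j => m j j) φ + diagOp b (fun j => m j (j + 1)) (flipOp b φ) :=
      fun m φ => by simp [siteOp]
    rw [e, e, inner_add_left, inner_add_right]
    have hx : ∀ x : Fin 2, x + 1 + 1 = x := by decide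
    congr 1
    · simp only [lp.inner_eq_tsum, diagOp_apply]
      refine tsum_congr fun c => ?_
      simp [Matrix.star_apply]
      ring
    · simp only [lp.inner_eq_tsum, diagOp_apply, flipOp_apply]
      rw [← (flip b).tsum_eq]
      refine tsum_congr fun c => ?_
      simp [Matrix.star_apply, flip_flip, flip_same, hx]
      ring

theorem siteHom_apply (b : Bond) (m : Matrix (Fin 2) (Fin 2) ℂ) (ψ : Hilb) (c : Config) :
    siteHom b m ψ c = m (c b) (c b) * ψ c + m (c b) (c b + 1) * ψ (flip b c) :=
  siteOp_apply' b m ψ c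

theorem commute_siteHom {b b' : Bond} (h : b ≠ b') (m n : Matrix (Fin 2) (Fin 2) ℂ) :
    Commute (siteHom b m) (siteHom b' n) := by
  ext ψ c
  have hc : flip b' (flip b c) = flip b (flip b' c) := by
    simp [flip, add_right_comm]
  simp only [siteHom_apply, mul_apply_eq_comp, flip_ne h, flip_ne h.symm, hc]
  ring

/-- The operators generated, in norm, by the observables at all bonds. -/
noncomputable def quasiLocalSubalgebra : StarSubalgebra ℂ (Hilb →L[ℂ] Hilb) :=
  (StarAlgebra.adjoin ℂ {a | ∃ b m, a = siteHom b m}).topologicalClosure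

/-- The C⋆-algebra of quasi-local observables: the norm completion of the increasing union of the
local matrix algebras `⨂_{b ∈ Λ} M₂(ℂ)`, `Λ` a finite set of bonds. -/
def QuasiLocal : Type := quasiLocalSubalgebra

instance : IsClosed (quasiLocalSubalgebra : Set (Hilb →L[ℂ] Hilb)) :=
  StarSubalgebra.isClosed_topologicalClosure _

noncomputable instance : CStarAlgebra QuasiLocal :=
  inferInstanceAs (CStarAlgebra quasiLocalSubalgebra)

/-- The order of the C⋆-algebra `QuasiLocal`, whose positive elements are the `star a * a`. -/
noncomputable instance : PartialOrder QuasiLocal := CStarAlgebra.spectralOrder QuasiLocal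

instance : StarOrderedRing QuasiLocal := CStarAlgebra.spectralOrderedRing QuasiLocal

/-- The matrix `m` acting on the spin at the bond `b`, as a quasi-local observable. -/
noncomputable def obs (b : Bond) : Matrix (Fin 2) (Fin 2) ℂ →⋆ₐ[ℂ] QuasiLocal :=
  (siteHom b).codRestrict quasiLocalSubalgebra fun m =>
    StarSubalgebra.le_topologicalClosure _ (StarAlgebra.subset_adjoin ℂ _ ⟨b, m, rfl⟩)

/-- The inclusion of the quasi-local algebra in the operators on `Hilb`. -/
noncomputable def incl : QuasiLocal →⋆ₐ[ℂ] (Hilb →L[ℂ] Hilb) := quasiLocalSubalgebra.subtype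

theorem incl_obs (b : Bond) (m : Matrix (Fin 2) (Fin 2) ℂ) : incl (obs b m) = siteHom b m := rfl

theorem incl_injective : Function.Injective incl := Subtype.val_injective

/-- The local observables supported in a set of bonds `Λ`: the union of the local algebras of the
finite subsets of `Λ`. -/
noncomputable def localObs (Λ : Set Bond) : StarSubalgebra ℂ QuasiLocal :=
  StarAlgebra.adjoin ℂ {a | ∃ b ∈ Λ, ∃ m, a = obs b m}

/-- The algebra `𝔄(Λ)` of observables localised in a set of bonds `Λ`. -/
noncomputable def observables (Λ : Set Bond) : StarSubalgebra ℂ QuasiLocal :=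
  (localObs Λ).topologicalClosure

theorem isometry_incl : Isometry incl := isometry_subtype_coe

theorem observables_univ : observables Set.univ = ⊤ := by
  have hcl : IsClosed (((observables Set.univ).map incl : StarSubalgebra ℂ (Hilb →L[ℂ] Hilb)) :
      Set (Hilb →L[ℂ] Hilb)) := by
    rw [StarSubalgebra.coe_map]
    exact isometry_incl.isClosedEmbedding.isClosedMap _
      (StarSubalgebra.isClosed_topologicalClosure _)
  have hle : quasiLocalSubalgebra ≤ (observables Set.univ).map incl := by
    refine StarSubalgebra.topologicalClosure_minimal (StarAlgebra.adjoin_le ?_) hcl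
    rintro _ ⟨b, m, rfl⟩
    exact ⟨obs b m, StarSubalgebra.le_topologicalClosure _
      (StarAlgebra.subset_adjoin ℂ _ ⟨b, trivial, m, rfl⟩), rfl⟩
  refine eq_top_iff.mpr fun a _ => ?_
  obtain ⟨a', ha', h⟩ := hle a.2
  exact incl_injective (h : incl a' = incl a) ▸ ha'

theorem mem_closure_localObs (a : QuasiLocal) : a ∈ closure (localObs Set.univ : Set QuasiLocal) := by
  rw [← StarSubalgebra.topologicalClosure_coe]
  exact (observables_univ ▸ trivial : a ∈ observables Set.univ)

/-- The Pauli matrices `σˣ` and `σᶻ`. -/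
inductive Pauli : Type
  | x : Pauli
  | z : Pauli

/-- The Pauli matrix with the given label. -/
def Pauli.matrix : Pauli → Matrix (Fin 2) (Fin 2) ℂ
  | .x => !![0, 1; 1, 0]
  | .z => !![1, 0; 0, -1]

/-- The Pauli matrix `P` at the bond `b`. -/
noncomputable def pauli (P : Pauli) (b : Bond) : QuasiLocal := obs b P.matrix

theorem star_pauli (P : Pauli) (b : Bond) : star (pauli P b) = pauli P b := by
  rw [pauli, ← map_star]
  congr 1
  cases P <;> ext i j <;> fin_cases i <;> fin_cases j <;> simp [Pauli.matrix, Matrix.star_apply]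

theorem pauli_mul_self (P : Pauli) (b : Bond) : pauli P b * pauli P b = 1 := by
  rw [pauli, ← map_mul, ← map_one (obs b)]
  congr 1
  cases P <;> ext i j <;> fin_cases i <;> fin_cases j <;> simp [Pauli.matrix]

/-- The points of `ℤ²`. They label both the vertices of the lattice and its plaquettes, the
plaquette `p` being the unit square with lower left corner `p`. -/
abbrev Point : Type := ℤ × ℤ

/-- The four bonds that end at the vertex `s`. -/
def starBonds (s : Point) : List Bond :=
  [.hor s.1 s.2, .hor (s.1 - 1) s.2, .ver s.1 s.2, .ver s.1 (s.2 - 1)]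

/-- The four bonds that enclose the plaquette `p`. -/
def plaqBonds (p : Point) : List Bond :=
  [.hor p.1 p.2, .hor p.1 (p.2 + 1), .ver p.1 p.2, .ver (p.1 + 1) p.2]

/-- The star operator `A_s`. -/
noncomputable def starOp (s : Point) : QuasiLocal := ((starBonds s).map (pauli .x)).prod

/-- The plaquette operator `B_p`. -/
noncomputable def plaqOp (p : Point) : QuasiLocal := ((plaqBonds p).map (pauli .z)).prod

/-- The states of the quasi-local algebra. -/
structure State where
  /-- the positive linear functional -/
  toFunctional : QuasiLocal →ₚ[ℂ] ℂ
  map_one : toFunctional 1 = 1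

/-- The ground state of the toric code: the state in which every term `-A_s` and `-B_p` of the
Hamiltonian attains its least value `-1`. -/
def State.IsGroundState (ω : State) : Prop :=
  (∀ s, ω.toFunctional (starOp s) = 1) ∧ ∀ p, ω.toFunctional (plaqOp p) = 1

theorem commute_obs {b b' : Bond} (h : b ≠ b') (m n : Matrix (Fin 2) (Fin 2) ℂ) :
    Commute (obs b m) (obs b' n) :=
  incl_injective (by simpa [incl_obs] using (commute_siteHom h m n).eq)

/-- The string operator of a finite string of Pauli matrices, the product of its first `n` letters.
The order of the factors only affects the sign. -/
noncomputable def stringOp (w : ℕ → Pauli × Bond) : ℕ → QuasiLocal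
  | 0 => 1
  | n + 1 => stringOp w n * pauli (w n).1 (w n).2

theorem stringOp_mem_unitary (w : ℕ → Pauli × Bond) (n : ℕ) :
    stringOp w n ∈ unitary QuasiLocal := by
  induction n with
  | zero => exact one_mem _
  | succ n ih =>
    refine mul_mem ih ?_
    rw [Unitary.mem_iff, star_pauli, pauli_mul_self]
    exact ⟨rfl, rfl⟩

/-- Conjugation by the string operator, `a ↦ Γₙ a Γₙ⋆`. -/
noncomputable def adString (w : ℕ → Pauli × Bond) (n : ℕ) (a : QuasiLocal) : QuasiLocal :=
  stringOp w n * a * star (stringOp w n)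

theorem norm_adString (w : ℕ → Pauli × Bond) (n : ℕ) (a : QuasiLocal) :
    ‖adString w n a‖ = ‖a‖ := by
  have h := stringOp_mem_unitary w n
  rw [adString, CStarRing.norm_mul_mem_unitary _ (Unitary.star_mem h),
    CStarRing.norm_mem_unitary_mul _ h]

theorem adString_sub (w : ℕ → Pauli × Bond) (n : ℕ) (a b : QuasiLocal) :
    adString w n (a - b) = adString w n a - adString w n b := by
  simp [adString, mul_sub, sub_mul]

/-- A string that meets each bond only finitely often. -/
def LocallyFinite (w : ℕ → Pauli × Bond) : Prop := ∀ b, ∀ᶠ n in atTop, (w n).2 ≠ b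

theorem eventually_commute {w : ℕ → Pauli × Bond} (hw : LocallyFinite w) {a : QuasiLocal}
    (ha : a ∈ localObs Set.univ) : ∀ᶠ n in atTop, Commute (pauli (w n).1 (w n).2) a := by
  induction ha using StarAlgebra.adjoin_induction with
  | mem a h =>
    obtain ⟨b, -, m, rfl⟩ := h
    filter_upwards [hw b] with n hn
    exact commute_obs hn _ _
  | algebraMap r => exact Eventually.of_forall fun n => (Algebra.commutes r _).symm
  | add a b _ _ h h' => filter_upwards [h, h'] with n hn hn' using hn.add_right hn'
  | mul a b _ _ h h' => filter_upwards [h, h'] with n hn hn' using hn.mul_right hn'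
  | star a _ h =>
    filter_upwards [h] with n hn
    have := hn.star_star
    rwa [star_pauli] at this

theorem adString_succ (w : ℕ → Pauli × Bond) (n : ℕ) {a : QuasiLocal}
    (h : Commute (pauli (w n).1 (w n).2) a) : adString w (n + 1) a = adString w n a := by
  simp only [adString, stringOp, star_mul, star_pauli]
  calc stringOp w n * pauli (w n).1 (w n).2 * a * (pauli (w n).1 (w n).2 * star (stringOp w n))
      = stringOp w n * (pauli (w n).1 (w n).2 * a) * pauli (w n).1 (w n).2 *
          star (stringOp w n) := by simp only [mul_assoc]
    _ = stringOp w n * a * (pauli (w n).1 (w n).2 * pauli (w n).1 (w n).2) *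
          star (stringOp w n) := by rw [h.eq]; simp only [mul_assoc]
    _ = _ := by rw [pauli_mul_self, mul_one]

theorem exists_tendsto_adString {w : ℕ → Pauli × Bond} (hw : LocallyFinite w) (a : QuasiLocal) :
    ∃ a', Tendsto (fun n => adString w n a) atTop (𝓝 a') := by
  refine cauchySeq_tendsto_of_complete (Metric.cauchySeq_iff.mpr fun ε hε => ?_)
  obtain ⟨c, hc, hac⟩ := Metric.mem_closure_iff.mp (mem_closure_localObs a) (ε / 2) (by positivity)
  obtain ⟨N, hN⟩ := eventually_atTop.mp (eventually_commute hw hc)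
  have hconst : ∀ n ≥ N, adString w n c = adString w N c := fun n hn => by
    induction n, hn using Nat.le_induction with
    | base => rfl
    | succ n hn ih => rw [adString_succ w n (hN n hn), ih]
  have hclose : ∀ n ≥ N, dist (adString w n a) (adString w N c) < ε / 2 := fun n hn => by
    rw [← hconst n hn, dist_eq_norm, ← adString_sub, norm_adString, ← dist_eq_norm]
    exact hac
  refine ⟨N, fun m hm n hn => ?_⟩
  have := dist_triangle_right (adString w m a) (adString w n a) (adString w N c)
  linarith [hclose m hm, hclose n hn]

/-- The norm limit `lim_n Γₙ a Γₙ⋆`. -/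
noncomputable def limString (w : ℕ → Pauli × Bond) (a : QuasiLocal) : QuasiLocal :=
  limUnder atTop fun n => adString w n a

theorem tendsto_limString {w : ℕ → Pauli × Bond} (hw : LocallyFinite w) (a : QuasiLocal) :
    Tendsto (fun n => adString w n a) atTop (𝓝 (limString w a)) :=
  tendsto_nhds_limUnder (exists_tendsto_adString hw a)

/-- The `*`-endomorphism `ρ = lim_n Ad Γₙ` of the quasi-local algebra. -/
noncomputable def stringEndo (w : ℕ → Pauli × Bond) (hw : LocallyFinite w) :
    QuasiLocal →⋆ₐ[ℂ] QuasiLocal where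
  toFun := limString w
  map_one' := by
    refine tendsto_nhds_unique (tendsto_limString hw 1) (tendsto_const_nhds.congr fun n => ?_)
    simp [adString, Unitary.mul_star_self_of_mem (stringOp_mem_unitary w n)]
  map_mul' a b := by
    refine tendsto_nhds_unique (tendsto_limString hw _)
      (((tendsto_limString hw a).mul (tendsto_limString hw b)).congr fun n => ?_)
    have h := Unitary.star_mul_self_of_mem (stringOp_mem_unitary w n)
    calc stringOp w n * a * star (stringOp w n) * (stringOp w n * b * star (stringOp w n))
        = stringOp w n * a * (star (stringOp w n) * stringOp w n) * b * star (stringOp w n) := by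
          simp only [mul_assoc]
      _ = _ := by rw [h, mul_one, adString, mul_assoc (stringOp w n) a b]
  map_zero' := by
    refine tendsto_nhds_unique (tendsto_limString hw 0) (tendsto_const_nhds.congr fun n => ?_)
    simp [adString]
  map_add' a b := by
    refine tendsto_nhds_unique (tendsto_limString hw _)
      (((tendsto_limString hw a).add (tendsto_limString hw b)).congr fun n => ?_)
    simp [adString, mul_add, add_mul]
  commutes' r := by
    refine tendsto_nhds_unique (tendsto_limString hw _) (tendsto_const_nhds.congr fun n => ?_)
    rw [adString, ← Algebra.commutes, mul_assoc,
      Unitary.mul_star_self_of_mem (stringOp_mem_unitary w n), mul_one]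
  map_star' a := by
    refine tendsto_nhds_unique (tendsto_limString hw _)
      ((tendsto_limString hw a).star.congr fun n => ?_)
    simp [adString, mul_assoc]

/-- The state `ω ∘ φ`. -/
noncomputable def State.comp (ω : State) (φ : QuasiLocal →⋆ₐ[ℂ] QuasiLocal) : State where
  toFunctional := ω.toFunctional.comp (PositiveLinearMap.ofClass φ)
  map_one := by
    change ω.toFunctional (φ 1) = 1
    rw [_root_.map_one, ω.map_one]

theorem State.comp_apply (ω : State) (φ : QuasiLocal →⋆ₐ[ℂ] QuasiLocal) (a : QuasiLocal) :
    (ω.comp φ).toFunctional a = ω.toFunctional (φ a) := rfl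

/-- The three types of excitations. -/
inductive Kind : Type
  | X : Kind
  | Y : Kind
  | Z : Kind

/-- The vertex `v` is a corner of the plaquette `p`. -/
def IsCorner (v p : Point) : Prop :=
  (v.1 = p.1 ∨ v.1 = p.1 + 1) ∧ (v.2 = p.2 ∨ v.2 = p.2 + 1)

/-- The sites of an excitation: vertices for the type `Z`, plaquettes for the type `X`, and
pairs of a plaquette and one of its corners for the type `Y`. -/
def Site : Kind → Type
  | .X => Point
  | .Y => {s : Point × Point // IsCorner s.1 s.2}
  | .Z => Point

/-- `b` is the only bond that the two sets of bonds have in common. -/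
def MeetIn (l l' : List Bond) (b : Bond) : Prop := ∀ b', (b' ∈ l ∧ b' ∈ l') ↔ b' = b

/-- One step of a path between neighbouring sites, with the Pauli matrix it contributes to
the string operator. A step between vertices contributes `σᶻ` at the bond that joins them, a step
between plaquettes `σˣ` at the bond that separates them. A step of a ribbon moves either the vertex
or the plaquette. -/
def Step : (k : Kind) → Site k → Site k → Pauli × Bond → Prop
  | .X, p, p', P => P.1 = .x ∧ MeetIn (plaqBonds p) (plaqBonds p') P.2
  | .Z, v, v', P => P.1 = .z ∧ MeetIn (starBonds v) (starBonds v') P.2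
  | .Y, s, s', P =>
    (s.1.2 = s'.1.2 ∧ P.1 = .z ∧ MeetIn (starBonds s.1.1) (starBonds s'.1.1) P.2) ∨
    (s.1.1 = s'.1.1 ∧ P.1 = .x ∧ MeetIn (plaqBonds s.1.2) (plaqBonds s'.1.2) P.2)

/-- A path of type `k` that starts at the site `x` and extends to infinity. -/
structure InfinitePath (k : Kind) (x : Site k) where
  /-- the sites of the path -/
  site : ℕ → Site k
  /-- the bonds of the path, with the Pauli matrices of its string operators -/
  letter : ℕ → Pauli × Bond
  site_zero : site 0 = x
  step : ∀ n, Step k (site n) (site (n + 1)) (letter n)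
  tendsto_site : Tendsto site atTop cofinite

/-- The sites next to a bond. -/
def Site.near (b : Bond) : (k : Kind) → Set (Site k)
  | .X => {p | b ∈ plaqBonds p}
  | .Y => {s | b ∈ starBonds s.1.1 ∨ b ∈ plaqBonds s.1.2}
  | .Z => {v | b ∈ starBonds v}

theorem Site.finite_near (b : Bond) (k : Kind) : (Site.near b k).Finite := by
  obtain ⟨i, j, hs, hp⟩ : ∃ i j : ℤ, (∀ s, b ∈ starBonds s → s.1 ∈ Set.Icc (i - 2) (i + 2) ∧
      s.2 ∈ Set.Icc (j - 2) (j + 2)) ∧ (∀ s, b ∈ plaqBonds s → s.1 ∈ Set.Icc (i - 2) (i + 2) ∧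
      s.2 ∈ Set.Icc (j - 2) (j + 2)) := by
    cases b with
    | hor i j =>
      refine ⟨i, j, fun s h => ?_, fun s h => ?_⟩ <;>
        simp only [starBonds, plaqBonds, List.mem_cons, Bond.hor.injEq, reduceCtorEq,
          List.not_mem_nil, or_false, Set.mem_Icc] at h ⊢ <;> omega
    | ver i j =>
      refine ⟨i, j, fun s h => ?_, fun s h => ?_⟩ <;>
        simp only [starBonds, plaqBonds, List.mem_cons, Bond.ver.injEq, reduceCtorEq,
          List.not_mem_nil, or_false, false_or, Set.mem_Icc] at h ⊢ <;> omega
  have hfin : ∀ i j : ℤ, (Set.Icc i (i + 8) ×ˢ Set.Icc j (j + 8) : Set Point).Finite :=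
    fun i j => (Set.finite_Icc _ _).prod (Set.finite_Icc _ _)
  cases k with
  | X =>
    refine (hfin (i - 4) (j - 4)).subset fun p h => ?_
    have := hp p h
    simp only [Set.mem_Icc, Set.mem_prod] at this ⊢
    omega
  | Z =>
    refine (hfin (i - 4) (j - 4)).subset fun p h => ?_
    have := hs p h
    simp only [Set.mem_Icc, Set.mem_prod] at this ⊢
    omega
  | Y =>
    refine Set.Finite.subset (((hfin (i - 4) (j - 4)).prod (hfin (i - 4) (j - 4))).preimage
      (f := fun s : {s : Point × Point // IsCorner s.1 s.2} => s.1)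
      Subtype.val_injective.injOn) ?_
    rintro ⟨⟨v, p⟩, hvp⟩ h
    simp only [Set.mem_preimage, Set.mem_prod, Set.mem_Icc]
    simp only [IsCorner] at hvp
    rcases h with h | h
    · have := hs v h
      simp only [Set.mem_Icc] at this
      omega
    · have := hp p h
      simp only [Set.mem_Icc] at this
      omega

theorem Step.mem_near : ∀ {k : Kind} {s s' : Site k} {P : Pauli × Bond}, Step k s s' P →
    s ∈ Site.near P.2 k
  | .X, _, _, _, h => ((h.2 _).mpr rfl).1
  | .Z, _, _, _, h => ((h.2 _).mpr rfl).1
  | .Y, _, _, _, .inl h => Or.inl ((h.2.2 _).mpr rfl).1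
  | .Y, _, _, _, .inr h => Or.inr ((h.2.2 _).mpr rfl).1

theorem InfinitePath.locallyFinite {k : Kind} {x : Site k} (γ : InfinitePath k x) :
    LocallyFinite γ.letter := fun b => by
  filter_upwards [γ.tendsto_site (Site.finite_near b k).compl_mem_cofinite] with n hn h
  exact hn (h ▸ (γ.step n).mem_near)

/-- The endomorphism `ρ = lim_n Ad Γₙ` defined by a path to infinity, `Γₙ` being the string operator
of its first `n` steps. -/
noncomputable def InfinitePath.endo {k : Kind} {x : Site k} (γ : InfinitePath k x) :
    QuasiLocal →⋆ₐ[ℂ] QuasiLocal :=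
  stringEndo γ.letter γ.locallyFinite

/-- The state `ω₀ ∘ ρ` with a single excitation of type `k` at the site `x`. -/
noncomputable def State.excite (ω₀ : State) {k : Kind} {x : Site k} (γ : InfinitePath k x) :
    State :=
  ω₀.comp γ.endo

/-- The states of type `k ∈ {0, X, Y, Z}` over `ω₀`: the state `ω₀` itself for `k = 0`, written
`none`, and the single-excitation states of type `k` at an arbitrary site otherwise. -/
inductive State.HasType (ω₀ : State) : Option Kind → State → Prop
  | ground : HasType ω₀ none ω₀
  | excited {k : Kind} {x : Site k} (γ : InfinitePath k x) : HasType ω₀ (some k) (ω₀.excite γ)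

/-- The GNS representations of `ω` and `ω'`, both restricted to the subalgebra `S`, are unitarily
equivalent. -/
def State.EquivOn (S : StarSubalgebra ℂ QuasiLocal) (ω ω' : State) : Prop :=
  ∃ U : ω.toFunctional.GNS ≃ₗᵢ[ℂ] ω'.toFunctional.GNS, ∀ a ∈ S, ∀ ξ,
    U (ω.toFunctional.gnsStarAlgHom a ξ) = ω'.toFunctional.gnsStarAlgHom a (U ξ)

/-- The GNS representations of `ω` and `ω'` are unitarily equivalent. -/
def State.Equivalent (ω ω' : State) : Prop := State.EquivOn ⊤ ω ω'

/-- A point of the lattice as a point of the plane. -/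
def toPlane (x : Point) : ℝ × ℝ := (x.1, x.2)

/-- The closed segment that a bond occupies in the plane. -/
def Bond.seg : Bond → Set (ℝ × ℝ)
  | .hor i j => segment ℝ (toPlane (i, j)) (toPlane (i + 1, j))
  | .ver i j => segment ℝ (toPlane (i, j)) (toPlane (i, j + 1))

/-- The half-line from `o` in the direction `u`. -/
def halfLine (o u : ℝ × ℝ) : Set (ℝ × ℝ) := {y | ∃ s : ℝ, 0 ≤ s ∧ y = o + s • u}

/-- The area bounded by the half-lines from `o` in the directions `u` and `w`. -/
def wedge (o u w : ℝ × ℝ) : Set (ℝ × ℝ) :=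
  {y | ∃ s t : ℝ, 0 ≤ s ∧ 0 ≤ t ∧ y = o + s • u + t • w}

/-- A cone of bonds: those inside the area between two half-lines from a common lattice point, or
that meet one of the half-lines. The angle between the half-lines lies strictly between `0` and `π`,
that is, their directions are linearly independent. -/
def IsCone (Λ : Set Bond) : Prop :=
  ∃ (o : Point) (u w : ℝ × ℝ), LinearIndependent ℝ ![u, w] ∧
    Λ = {b | b.seg ⊆ wedge (toPlane o) u w ∨ (b.seg ∩ halfLine (toPlane o) u).Nonempty ∨
      (b.seg ∩ halfLine (toPlane o) w).Nonempty}

theorem tendsto_cofinite_of_fst {f : ℕ → Point} (h : ∀ m : ℤ, {n | (f n).1 ≤ m}.Finite) :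
    Tendsto f atTop cofinite := by
  rw [← Nat.cofinite_eq_atTop]
  intro s hs
  rw [mem_map, mem_cofinite]
  rw [mem_cofinite] at hs
  obtain ⟨m, hm⟩ := (hs.image Prod.fst).bddAbove
  exact (h m).subset fun n hn => hm ⟨f n, hn, rfl⟩

theorem finite_le_of_add {f : ℕ → ℤ} (c : ℤ) (h : ∀ n : ℕ, (n : ℤ) ≤ 2 * f n + c) (m : ℤ) :
    {n | f n ≤ m}.Finite :=
  (Set.finite_Iic (2 * m + c).toNat).subset fun n hn => by
    have h1 : f n ≤ m := hn
    have := h n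
    simp only [Set.mem_Iic]
    omega

theorem meetIn_star (i j : ℤ) : MeetIn (starBonds (i, j)) (starBonds (i + 1, j)) (.hor i j) := by
  intro b
  cases b <;> simp only [starBonds, List.mem_cons, Bond.hor.injEq, Bond.ver.injEq, reduceCtorEq,
    List.not_mem_nil, or_false, false_or, iff_false] <;> omega

theorem meetIn_plaq (i j : ℤ) :
    MeetIn (plaqBonds (i, j)) (plaqBonds (i + 1, j)) (.ver (i + 1) j) := by
  intro b
  cases b <;> simp only [plaqBonds, List.mem_cons, Bond.hor.injEq, Bond.ver.injEq, reduceCtorEq,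
    List.not_mem_nil, or_false, false_or, iff_false] <;> omega

/-- Paths to infinity exist: the horizontal one to the right. -/
instance : ∀ (k : Kind) (x : Site k), Nonempty (InfinitePath k x)
  | .X, x => ⟨{
      site := fun n => ((x : Point).1 + n, (x : Point).2)
      letter := fun n => (.x, .ver ((x : Point).1 + n + 1) (x : Point).2)
      site_zero := Prod.ext (add_zero _) rfl
      step := fun n => ⟨rfl, by
        have := meetIn_plaq ((x : Point).1 + n) (x : Point).2
        simpa [add_assoc] using this⟩
      tendsto_site := tendsto_cofinite_of_fst
        (finite_le_of_add (2 * |(x : Point).1|) fun n => by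
          have := neg_abs_le (x : Point).1
          dsimp only
          omega) }⟩
  | .Z, x => ⟨{
      site := fun n => ((x : Point).1 + n, (x : Point).2)
      letter := fun n => (.z, .hor ((x : Point).1 + n) (x : Point).2)
      site_zero := Prod.ext (add_zero _) rfl
      step := fun n => ⟨rfl, by
        have := meetIn_star ((x : Point).1 + n) (x : Point).2
        simpa [add_assoc] using this⟩
      tendsto_site := tendsto_cofinite_of_fst
        (finite_le_of_add (2 * |(x : Point).1|) fun n => by
          have := neg_abs_le (x : Point).1
          dsimp only
          omega) }⟩
  | .Y, ⟨(v, p), hvp⟩ => ⟨{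
      site := fun n => ⟨((p.1 + (n + (v.1 - p.1) + 1) / 2, v.2), (p.1 + (n + (v.1 - p.1)) / 2, p.2)),
        by
          obtain ⟨h1, h2⟩ := hvp
          dsimp only at h1 h2
          refine ⟨?_, h2⟩
          dsimp only
          omega⟩
      letter := fun n => if (n + (v.1 - p.1)) % 2 = 0 then
          (.z, .hor (p.1 + (n + (v.1 - p.1)) / 2) v.2)
        else (.x, .ver (p.1 + (n + (v.1 - p.1)) / 2 + 1) p.2)
      site_zero := by
        obtain ⟨h1, h2⟩ := hvp
        dsimp only at h1 h2
        refine Subtype.ext (Prod.ext (Prod.ext ?_ rfl) (Prod.ext ?_ rfl)) <;>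
        · dsimp only
          push_cast
          omega
      step := fun n => by
        split_ifs with h
        · refine Or.inl ⟨Prod.ext ?_ rfl, rfl, ?_⟩
          · dsimp only
            push_cast
            omega
          · have := meetIn_star (p.1 + (n + (v.1 - p.1)) / 2) v.2
            dsimp only
            have e1 : p.1 + ((n : ℤ) + (v.1 - p.1) + 1) / 2 = p.1 + (n + (v.1 - p.1)) / 2 := by
              omega
            have e2 : p.1 + (((n + 1 : ℕ) : ℤ) + (v.1 - p.1) + 1) / 2 =
                p.1 + (n + (v.1 - p.1)) / 2 + 1 := by
              push_cast
              omega
            rw [e1, e2]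
            exact this
        · refine Or.inr ⟨Prod.ext ?_ rfl, rfl, ?_⟩
          · dsimp only
            push_cast
            omega
          · have := meetIn_plaq (p.1 + (n + (v.1 - p.1)) / 2) p.2
            dsimp only
            have e2 : p.1 + (((n + 1 : ℕ) : ℤ) + (v.1 - p.1)) / 2 =
                p.1 + (n + (v.1 - p.1)) / 2 + 1 := by
              push_cast
              omega
            rw [e2]
            exact this
      tendsto_site := by
        have h := tendsto_cofinite_of_fst
          (f := fun n : ℕ => (p.1 + (n + (v.1 - p.1)) / 2, p.2))
          (finite_le_of_add (2 * |p.1| + |v.1| + |p.1| + 5) fun n => by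
            have := neg_abs_le p.1
            have := le_abs_self p.1
            have := neg_abs_le v.1
            dsimp only
            omega)
        intro s hs
        rw [mem_cofinite] at hs
        have h2 : ((fun t : Site .Y => t.1.2) '' sᶜ)ᶜ ∈ (cofinite : Filter Point) := by
          rw [mem_cofinite, compl_compl]
          exact Set.Finite.image _ hs
        have h3 := Filter.mem_map.mp (h h2)
        exact Filter.mem_map.mpr
          (mem_of_superset h3 fun n hn => by_contra fun hc => hn ⟨_, hc, rfl⟩) }⟩

theorem incl_pauli_x_apply (b : Bond) (ψ : Hilb) (c : Config) :
    incl (pauli .x b) ψ c = ψ (flip b c) := by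
  rw [pauli, incl_obs, siteHom_apply]
  generalize c b = x
  fin_cases x <;> simp [Pauli.matrix]

theorem incl_pauli_z_apply (b : Bond) (ψ : Hilb) (c : Config) :
    incl (pauli .z b) ψ c = (if c b = 0 then 1 else -1) * ψ c := by
  rw [pauli, incl_obs, siteHom_apply]
  generalize c b = x
  fin_cases x <;> simp [Pauli.matrix]

theorem pauli_x_mul_z (b b' : Bond) :
    pauli .x b * pauli .z b' = (if b = b' then (-1 : ℂ) else 1) • (pauli .z b' * pauli .x b) := by
  split_ifs with h
  · subst h
    rw [pauli, pauli, ← map_mul, ← map_mul, ← map_smul]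
    congr 1
    ext i j
    fin_cases i <;> fin_cases j <;> simp [Pauli.matrix]
  · rw [one_smul]
    exact commute_obs h _ _

theorem commute_pauli (P : Pauli) (b b' : Bond) : Commute (pauli P b) (pauli P b') := by
  by_cases h : b = b'
  · rw [h]
  · exact commute_obs h _ _

theorem commute_starOp (s t : Point) : Commute (starOp s) (starOp t) := by
  refine Commute.list_prod_left _ _ fun a ha => Commute.list_prod_right _ _ fun b hb => ?_
  obtain ⟨_, -, rfl⟩ := List.mem_map.mp ha
  obtain ⟨_, -, rfl⟩ := List.mem_map.mp hb
  exact commute_pauli _ _ _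

theorem starOp_mul_self (s : Point) : starOp s * starOp s = 1 := by
  have h : ∀ l : List Bond, (l.map (pauli .x)).prod * (l.map (pauli .x)).prod = 1 := by
    intro l
    induction l with
    | nil => simp
    | cons b l ih =>
      have hc : Commute (l.map (pauli .x)).prod (pauli .x b) :=
        Commute.list_prod_left _ _ fun a ha => by
          obtain ⟨_, -, rfl⟩ := List.mem_map.mp ha
          exact commute_pauli _ _ _
      rw [List.map_cons, List.prod_cons]
      calc _ = pauli .x b * ((l.map (pauli .x)).prod * pauli .x b) * (l.map (pauli .x)).prod := by
            simp only [mul_assoc]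
        _ = (pauli .x b * pauli .x b) * ((l.map (pauli .x)).prod * (l.map (pauli .x)).prod) := by
            rw [hc.eq]; simp only [mul_assoc]
        _ = 1 := by rw [ih, pauli_mul_self, one_mul]
  exact h _

theorem prod_x_mul_z (l : List Bond) (b' : Bond) :
    (l.map (pauli .x)).prod * pauli .z b' =
      (l.map fun b => if b = b' then (-1 : ℂ) else 1).prod •
        (pauli .z b' * (l.map (pauli .x)).prod) := by
  induction l with
  | nil => simp
  | cons b l ih =>
    simp only [List.map_cons, List.prod_cons]
    rw [mul_assoc, ih, mul_smul_comm, ← mul_assoc, pauli_x_mul_z, smul_mul_assoc, smul_smul,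
      mul_comm, mul_assoc]

theorem prod_x_mul_prod_z (l l' : List Bond) :
    (l.map (pauli .x)).prod * (l'.map (pauli .z)).prod =
      (l'.map fun b' => (l.map fun b => if b = b' then (-1 : ℂ) else 1).prod).prod •
        ((l'.map (pauli .z)).prod * (l.map (pauli .x)).prod) := by
  induction l' with
  | nil => simp
  | cons b l' ih =>
    simp only [List.map_cons, List.prod_cons]
    rw [← mul_assoc, prod_x_mul_z, smul_mul_assoc, mul_assoc, ih, mul_smul_comm, smul_smul,
      mul_assoc]

/-- Star and plaquette operators commute. -/
theorem commute_starOp_plaqOp (s p : Point) : Commute (starOp s) (plaqOp p) := by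
  have h := prod_x_mul_prod_z (starBonds s) (plaqBonds p)
  have hsign : ((plaqBonds p).map fun b' =>
      ((starBonds s).map fun b => if b = b' then (-1 : ℂ) else 1).prod).prod = 1 := by
    obtain ⟨a, b⟩ := s
    obtain ⟨i, j⟩ := p
    simp only [starBonds, plaqBonds, List.map_cons, List.map_nil, List.prod_cons, List.prod_nil,
      Bond.hor.injEq, Bond.ver.injEq, reduceCtorEq, if_false, mul_one, one_mul]
    by_cases h1 : a = i
    · subst h1
      by_cases h2 : b = j
      · subst h2; simp
      · by_cases h3 : b = j + 1
        · subst h3; simp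
        · have : b - 1 ≠ j := by omega
          simp [h2, h3, this]
    · by_cases h1' : a = i + 1
      · subst h1'
        by_cases h2 : b = j
        · subst h2; simp
        · by_cases h3 : b = j + 1
          · subst h3; simp
          · have : b - 1 ≠ j := by omega
            simp [h2, h3, this]
      · have : a - 1 ≠ i := by omega
        simp [h1, h1', this]
  rw [hsign, one_smul] at h
  exact h

/-- The vector of the configuration `0`, in which all plaquette operators are `1`. -/
noncomputable def zeroVec : Hilb := by
  classical exact lp.single 2 (0 : Config) (1 : ℂ)

theorem zeroVec_apply (c : Config) : zeroVec c = if c = 0 then 1 else 0 := by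
  classical
  rw [zeroVec, lp.single_apply]
  simp [Pi.single_apply]

theorem plaqOp_zeroVec (p : Point) : incl (plaqOp p) zeroVec = zeroVec := by
  have h : ∀ l : List Bond, incl ((l.map (pauli .z)).prod) zeroVec = zeroVec := by
    intro l
    induction l with
    | nil => simp
    | cons b l ih =>
      rw [List.map_cons, List.prod_cons, map_mul, mul_apply_eq_comp, ih]
      ext c
      rw [incl_pauli_z_apply, zeroVec_apply]
      split_ifs <;> simp_all
  exact h _

theorem starOp_apply (s : Point) (ψ : Hilb) (c : Config) :
    ∃ c', incl (starOp s) ψ c = ψ c' := by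
  have h : ∀ (l : List Bond) (ψ : Hilb) (c : Config),
      ∃ c', incl ((l.map (pauli .x)).prod) ψ c = ψ c' := by
    intro l
    induction l with
    | nil => exact fun ψ c => ⟨c, by simp⟩
    | cons b l ih =>
      intro ψ c
      rw [List.map_cons, List.prod_cons, map_mul, mul_apply_eq_comp, incl_pauli_x_apply]
      exact ih ψ _
  exact h _ ψ c

theorem exists_stabilized (S : Finset Point) : ∃ ξ : Hilb, ‖ξ‖ = 1 ∧
    (∀ s ∈ S, incl (starOp s) ξ = ξ) ∧ ∀ p, incl (plaqOp p) ξ = ξ := by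
  suffices h : ∃ ξ : Hilb, ξ ≠ 0 ∧ (∀ s ∈ S, incl (starOp s) ξ = ξ) ∧
      ∀ p, incl (plaqOp p) ξ = ξ by
    obtain ⟨ξ, h0, hs, hp⟩ := h
    refine ⟨((‖ξ‖⁻¹ : ℝ) : ℂ) • ξ, ?_, fun s h => by rw [map_smul, hs s h],
      fun p => by rw [map_smul, hp]⟩
    rw [norm_smul, Complex.norm_real, norm_inv, norm_norm,
      inv_mul_cancel₀ (norm_ne_zero_iff.mpr h0)]
  suffices h : ∃ ξ : Hilb, (∀ c, 0 ≤ ξ c) ∧ 1 ≤ ξ 0 ∧ (∀ s ∈ S, incl (starOp s) ξ = ξ) ∧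
      ∀ p, incl (plaqOp p) ξ = ξ by
    obtain ⟨ξ, -, h1, hs⟩ := h
    refine ⟨ξ, fun h => ?_, hs⟩
    rw [h, lp.coeFn_zero, Pi.zero_apply] at h1
    exact absurd h1 (by simp [Complex.le_def])
  classical
  induction S using Finset.induction_on with
  | empty =>
    refine ⟨zeroVec, fun c => ?_, ?_, by simp, plaqOp_zeroVec⟩
    · rw [zeroVec_apply]
      split_ifs <;> simp
    · simp [zeroVec_apply]
  | insert s S _ ih =>
    obtain ⟨ξ, h0, h1, hs, hp⟩ := ih
    have hc : ∀ a b : QuasiLocal, Commute a b → incl a ξ = ξ →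
        incl a (incl b ξ) = incl b ξ := fun a b hab ha => by
      rw [← mul_apply_eq_comp, ← map_mul, hab.eq, map_mul, mul_apply_eq_comp, ha]
    refine ⟨ξ + incl (starOp s) ξ, fun c => ?_, ?_, ?_, fun p => ?_⟩
    · obtain ⟨c', hc'⟩ := starOp_apply s ξ c
      rw [lp.coeFn_add, Pi.add_apply, hc']
      exact add_nonneg (h0 _) (h0 _)
    · obtain ⟨c', hc'⟩ := starOp_apply s ξ 0
      rw [lp.coeFn_add, Pi.add_apply, hc']
      exact le_add_of_le_of_nonneg h1 (h0 _)
    · intro t ht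
      rw [map_add]
      rcases Finset.mem_insert.mp ht with rfl | ht
      · rw [← mul_apply_eq_comp, ← map_mul, starOp_mul_self, map_one, one_apply_eq_self, add_comm]
      · rw [hs t ht, hc _ _ (commute_starOp t s) (hs t ht)]
    · rw [map_add, hp, hc _ _ (commute_starOp_plaqOp s p).symm (hp p)]

/-- The ground state exists. -/
theorem exists_isGroundState : ∃ ω : State, ω.IsGroundState := by
  choose ξ hξ hs hp using exists_stabilized
  let U : Ultrafilter (Finset Point) := Ultrafilter.of atTop
  have hU : (U : Filter (Finset Point)) ≤ atTop := Ultrafilter.of_le _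
  let φ : QuasiLocal → Finset Point → ℂ := fun a S => inner ℂ (ξ S) (incl a (ξ S))
  have hlim : ∀ a, ∃ z, Tendsto (φ a) U (𝓝 z) := by
    intro a
    have hmem : ∀ S, φ a S ∈ Metric.closedBall (0 : ℂ) ‖incl a‖ := fun S => by
      rw [mem_closedBall_zero_iff]
      calc ‖φ a S‖ ≤ ‖ξ S‖ * ‖incl a (ξ S)‖ := norm_inner_le_norm _ _
        _ ≤ ‖ξ S‖ * (‖incl a‖ * ‖ξ S‖) := by gcongr; exact (incl a).le_opNorm _
        _ = ‖incl a‖ := by rw [hξ]; ring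
    obtain ⟨z, -, hz⟩ := (isCompact_closedBall (0 : ℂ) ‖incl a‖).ultrafilter_le_nhds (U.map (φ a))
      (le_principal_iff.mpr (Filter.mem_map.mpr (Filter.univ_mem' hmem)))
    exact ⟨z, hz⟩
  choose f hf using hlim
  let F : QuasiLocal →ₗ[ℂ] ℂ :=
    { toFun := f
      map_add' := fun a b => tendsto_nhds_unique (hf (a + b)) (((hf a).add (hf b)).congr fun S => by
        simp [φ])
      map_smul' := fun r a => tendsto_nhds_unique (hf (r • a))
        (((hf a).const_mul r).congr fun S => by simp [φ]) }
  have hpos : ∀ a, 0 ≤ a → 0 ≤ F a := fun a ha => by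
    obtain ⟨b, rfl⟩ := CStarAlgebra.nonneg_iff_eq_star_mul_self.mp ha
    refine ge_of_tendsto (hf _) (Eventually.of_forall fun S => ?_)
    have : φ (star b * b) S = ((‖incl b (ξ S)‖ ^ 2 : ℝ) : ℂ) := by
      simp only [φ, map_mul, map_star, mul_apply_eq_comp, ContinuousLinearMap.star_eq_adjoint,
        ContinuousLinearMap.adjoint_inner_right]
      rw [inner_self_eq_norm_sq_to_K]
      simp
    rw [this]
    exact_mod_cast sq_nonneg ‖incl b (ξ S)‖
  have hval : ∀ a, (∀ᶠ S in atTop, incl a (ξ S) = ξ S) → f a = 1 := fun a ha => by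
    refine tendsto_nhds_unique (hf a) (tendsto_const_nhds.congr' ?_)
    filter_upwards [hU ha] with S hS
    simp [φ, hS, inner_self_eq_norm_sq_to_K, hξ]
  refine ⟨⟨PositiveLinearMap.mk₀ F hpos, hval 1 (Eventually.of_forall fun S => by simp)⟩,
    fun s => hval _ ?_, fun p => hval _ (Eventually.of_forall fun S => hp S p)⟩
  filter_upwards [eventually_ge_atTop {s}] with S hS
  exact hs S s (Finset.singleton_subset_iff.mp hS)

end ToricCode

/-! Call the star and plaquette operators checks. Everything is read off from the signs that they
take in a state. The state `ω₀` gives every check the value `1`. A string operator flips exactly the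
checks at the ends of its path, and one end escapes to infinity, so a single-excitation state gives
the value `-1` at its site and `1` at all other checks (`State.hasSigns_excite`).

Such a pattern of signs determines the state (`State.HasSigns.unique`). It is enough to evaluate a
product of Pauli matrices. If it anticommutes with some check, its expectation is `0`. Otherwise its
σˣ part and its σᶻ part are closed chains on the dual lattice and on the lattice, and since first
homology vanishes each is a product of checks (`exists_par_eq`), whose expectation is known.

Equal types give equivalent representations: a product of Pauli matrices along a finite path moves
an excitation to any other site, so by uniqueness the two states differ by an inner automorphism
(`State.HasSigns.equivalent`). Different types are separated by two total charges, one for stars and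
one for plaquettes. The product of all checks in a finite set `S` commutes with any given local
observable once `S` is large, and its value is then the parity of the number of excitations. A
unitary equivalence would have to match these values (`State.HasSigns.isSome_eq`).

For a cone, the required charges are created by strings that run to infinity inside the cone. The
resulting automorphism fixes `observables Λᶜ`, so it does not change the representation there, and
it produces a state with the same total charges as the given one. The previous equivalence finishes
the argument (`State.HasSigns.equivOn_compl_cone`). -/

namespace ToricCode

/-! ### GNS representations: intertwiners and eigenvectors -/

section GNS

open UniformSpace

theorem State.EquivOn.symm {S : StarSubalgebra ℂ QuasiLocal} {ω ω' : State}
    (h : State.EquivOn S ω ω') : State.EquivOn S ω' ω := by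
  obtain ⟨U, hU⟩ := h
  refine ⟨U.symm, fun a ha ξ => ?_⟩
  rw [LinearIsometryEquiv.symm_apply_eq, hU a ha, LinearIsometryEquiv.apply_symm_apply]

theorem State.EquivOn.trans {S : StarSubalgebra ℂ QuasiLocal} {ω ω' ω'' : State}
    (h : State.EquivOn S ω ω') (h' : State.EquivOn S ω' ω'') : State.EquivOn S ω ω'' := by
  obtain ⟨U, hU⟩ := h
  obtain ⟨V, hV⟩ := h'
  refine ⟨U.trans V, fun a ha ξ => ?_⟩
  rw [LinearIsometryEquiv.trans_apply, LinearIsometryEquiv.trans_apply, hU a ha, hV a ha]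

theorem State.EquivOn.mono {S S' : StarSubalgebra ℂ QuasiLocal} {ω ω' : State} (hS : S' ≤ S)
    (h : State.EquivOn S ω ω') : State.EquivOn S' ω ω' := by
  obtain ⟨U, hU⟩ := h
  exact ⟨U, fun a ha => hU a (hS ha)⟩

/-- A linear isometry of the pre-Hilbert spaces of two states extends to their completions. -/
theorem exists_isometry_completion (ω ω' : State) (T : QuasiLocal →ₗ[ℂ] QuasiLocal)
    (hT : ∀ a, ω'.toFunctional (star (T a) * T a) = ω.toFunctional (star a * a)) :
    ∃ V : ω.toFunctional.GNS →ₗᵢ[ℂ] ω'.toFunctional.GNS,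
      ∀ a, V ((ω.toFunctional.toPreGNS a : ω.toFunctional.PreGNS) : ω.toFunctional.GNS) =
        ((ω'.toFunctional.toPreGNS (T a) : ω'.toFunctional.PreGNS) : ω'.toFunctional.GNS) := by
  -- `PreGNS` is the algebra with a seminorm, without a quotient by null vectors, so `T` acts on it
  -- directly; null vectors disappear only in the completion.
  let T' : ω.toFunctional.PreGNS →ₗ[ℂ] ω'.toFunctional.PreGNS :=
    ω'.toFunctional.toPreGNS.toLinearMap ∘ₗ T ∘ₗ ω.toFunctional.ofPreGNS.toLinearMap
  have hnorm : ∀ a, ‖T' a‖ = ‖a‖ := fun a => by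
    rw [PositiveLinearMap.preGNS_norm_def, PositiveLinearMap.preGNS_norm_def]
    exact congrArg (fun z : ℂ => √z.re) (hT (ω.toFunctional.ofPreGNS a))
  let L : ω.toFunctional.PreGNS →L[ℂ] ω'.toFunctional.PreGNS :=
    T'.mkContinuous 1 fun a => by rw [hnorm, one_mul]
  have hL : ∀ a : ω.toFunctional.PreGNS, L.completion (a : ω.toFunctional.GNS) =
      ((T' a : ω'.toFunctional.PreGNS) : ω'.toFunctional.GNS) := fun a => by
    rw [ContinuousLinearMap.completion_apply_coe]
    rfl
  refine ⟨⟨L.completion.toLinearMap, fun ξ => ?_⟩, fun a => hL _⟩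
  induction ξ using Completion.induction_on with
  | hp => exact isClosed_eq (L.completion.continuous.norm) continuous_norm
  | ih a =>
    change ‖L.completion (a : ω.toFunctional.GNS)‖ = _
    rw [hL, Completion.norm_coe, Completion.norm_coe, hnorm]

/-- A surjective linear map that preserves the pre-inner products and commutes with left
multiplication by `S` gives an equivalence of the GNS representations on `S`. -/
theorem State.EquivOn.of_linearMap {S : StarSubalgebra ℂ QuasiLocal} {ω ω' : State}
    (T : QuasiLocal →ₗ[ℂ] QuasiLocal) (hsurj : Function.Surjective T)
    (hT : ∀ a, ω'.toFunctional (star (T a) * T a) = ω.toFunctional (star a * a))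
    (hS : ∀ b ∈ S, ∀ a, T (b * a) = b * T a) : State.EquivOn S ω ω' := by
  obtain ⟨V, hV⟩ := exists_isometry_completion ω ω' T hT
  have hVs : Function.Surjective V := by
    rw [← Set.range_eq_univ, ← (V.isometry.isClosedEmbedding.isClosed_range).closure_eq]
    refine Set.eq_univ_of_univ_subset ?_
    rw [← Completion.denseRange_coe.closure_range]
    refine closure_mono ?_
    rintro _ ⟨a, rfl⟩
    obtain ⟨b, hb⟩ := hsurj (ω'.toFunctional.ofPreGNS a)
    refine ⟨_, (hV b).trans ?_⟩
    rw [hb]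
    rfl
  refine ⟨LinearIsometryEquiv.ofSurjective V hVs, fun b hb ξ => ?_⟩
  rw [LinearIsometryEquiv.coe_ofSurjective]
  induction ξ using Completion.induction_on with
  | hp =>
    exact isClosed_eq (V.continuous.comp (ContinuousLinearMap.continuous _))
      ((ContinuousLinearMap.continuous _).comp V.continuous)
  | ih a =>
    have h1 : ∀ (ω : State) (c : QuasiLocal), ω.toFunctional.gnsStarAlgHom b
        ((ω.toFunctional.toPreGNS c : ω.toFunctional.PreGNS) : ω.toFunctional.GNS) =
        ((ω.toFunctional.toPreGNS (b * c) : ω.toFunctional.PreGNS) : ω.toFunctional.GNS) :=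
      fun ω c => by
        change ω.toFunctional.gnsNonUnitalStarAlgHom b _ = _
        rw [PositiveLinearMap.gnsNonUnitalStarAlgHom_apply_coe]
        rfl
    obtain ⟨c, rfl⟩ : ∃ c, ω.toFunctional.toPreGNS c = a := ⟨_, rfl⟩
    rw [h1, hV, hV, h1, hS b hb]

/-- The map `a ↦ α a` carries the form of `ω ∘ α` to that of `ω`, and it intertwines left
multiplication by those `b` that `α` fixes. Surjectivity of `α` makes the induced isometry unitary.
-/
theorem State.equivOn_comp {S : StarSubalgebra ℂ QuasiLocal} (ω : State)
    (α : QuasiLocal →⋆ₐ[ℂ] QuasiLocal) (hα : Function.Surjective α) (hS : ∀ b ∈ S, α b = b) :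
    State.EquivOn S (ω.comp α) ω :=
  State.EquivOn.of_linearMap α.toAlgHom.toLinearMap hα
    (fun a => by
      change ω.toFunctional (star (α a) * α a) = ω.toFunctional (α (star a * a))
      rw [map_mul α, map_star α])
    fun b hb a => by
      change α (b * a) = b * α a
      rw [map_mul, hS b hb]

/-- The intertwiner is right multiplication by `u⋆`, which commutes with all left multiplications.
It expresses that `ω ∘ Ad u` is the vector state of `π(u⋆)Ω`. -/
theorem State.equivalent_comp_conj (ω : State) (u : unitary QuasiLocal) :
    (ω.comp (Unitary.conjStarAlgAut ℂ QuasiLocal u : QuasiLocal →⋆ₐ[ℂ] QuasiLocal)).Equivalent ω :=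
  State.EquivOn.of_linearMap (LinearMap.mulRight ℂ (star (u : QuasiLocal)))
    (fun a => ⟨a * u, by simp [mul_assoc]⟩)
    (fun a => by
      rw [State.comp_apply]
      simp [mul_assoc])
    fun b _ a => by simp [mul_assoc]

/-- The vector of the state in its GNS representation. -/
noncomputable def State.vec (ω : State) : ω.toFunctional.GNS :=
  (ω.toFunctional.toPreGNS 1 : ω.toFunctional.PreGNS)

theorem State.gns_vec (ω : State) (a : QuasiLocal) : ω.toFunctional.gnsStarAlgHom a ω.vec =
    ((ω.toFunctional.toPreGNS a : ω.toFunctional.PreGNS) : ω.toFunctional.GNS) := by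
  change ω.toFunctional.gnsNonUnitalStarAlgHom a _ = _
  rw [State.vec, PositiveLinearMap.gnsNonUnitalStarAlgHom_apply_coe]
  change ((ω.toFunctional.toPreGNS (a * 1) : ω.toFunctional.PreGNS) : ω.toFunctional.GNS) = _
  rw [mul_one]

theorem State.inner_gns_vec (ω : State) (a b : QuasiLocal) :
    inner ℂ (ω.toFunctional.gnsStarAlgHom a ω.vec) (ω.toFunctional.gnsStarAlgHom b ω.vec) =
      ω.toFunctional (star a * b) := by
  rw [State.gns_vec, State.gns_vec, Completion.inner_coe]
  rfl

theorem State.norm_vec (ω : State) : ‖ω.vec‖ = 1 := by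
  have h := ω.inner_gns_vec 1 1
  rw [_root_.map_one, one_apply_eq_self, inner_self_eq_norm_sq_to_K, star_one, one_mul,
    ω.map_one] at h
  have h2 := congrArg norm h
  rw [norm_pow, RCLike.norm_ofReal, abs_norm, norm_one] at h2
  exact (pow_eq_one_iff_of_nonneg (norm_nonneg _) two_ne_zero).mp h2

/-- The vectors of local observables are dense in the GNS space. -/
theorem State.exists_local_near (ω : State) (ξ : ω.toFunctional.GNS) {ε : ℝ} (hε : 0 < ε) :
    ∃ a ∈ localObs Set.univ, ‖ξ - ω.toFunctional.gnsStarAlgHom a ω.vec‖ < ε := by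
  obtain ⟨_, ⟨b, rfl⟩, hb⟩ := Metric.mem_closure_iff.mp
    (Completion.denseRange_coe ξ : ξ ∈ closure (Set.range _)) (ε / 2) (by positivity)
  obtain ⟨b, rfl⟩ : ∃ c, ω.toFunctional.toPreGNS c = b := ⟨_, rfl⟩
  rw [← ω.gns_vec, dist_eq_norm] at hb
  have hc : Continuous fun a => ω.toFunctional.gnsStarAlgHom a ω.vec := by
    have : Continuous ω.toFunctional.gnsStarAlgHom := map_continuous _
    fun_prop
  obtain ⟨a, ha, ha'⟩ := mem_closure_iff_nhds.mp (mem_closure_localObs b) _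
    (hc.continuousAt.preimage_mem_nhds (Metric.ball_mem_nhds _ (half_pos hε)))
  refine ⟨a, ha', ?_⟩
  have ha : dist (ω.toFunctional.gnsStarAlgHom a ω.vec) (ω.toFunctional.gnsStarAlgHom b ω.vec)
    < ε / 2 := ha
  rw [dist_comm, dist_eq_norm] at ha
  have := norm_sub_le_norm_sub_add_norm_sub ξ (ω.toFunctional.gnsStarAlgHom b ω.vec)
    (ω.toFunctional.gnsStarAlgHom a ω.vec)
  linarith

/-- A unitary with expectation `ε = ±1` has the state as an eigenvector. -/
theorem State.gns_vec_of_eq (ω : State) {W : QuasiLocal} (hW : star W * W = 1) {ε : ℂ}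
    (hε : star ε * ε = 1) (h : ω.toFunctional W = ε) :
    ω.toFunctional.gnsStarAlgHom W ω.vec = ε • ω.vec := by
  have e1 : ε • ω.vec = ω.toFunctional.gnsStarAlgHom (algebraMap ℂ _ ε) ω.vec := by
    rw [AlgHomClass.commutes]
    simp [Algebra.algebraMap_eq_smul_one]
  have hs : ω.toFunctional (star W) = star ε := by rw [map_star, h]
  rw [e1, ← sub_eq_zero, ← sub_apply, ← map_sub, ← inner_self_eq_zero (𝕜 := ℂ),
    State.inner_gns_vec]
  -- The squared norm of `(W - ε)Ω` is the expectation of this element, namely `2 - εω(W⋆) - ε̄ω(W)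
  -- = 0`.
  have : star (W - algebraMap ℂ QuasiLocal ε) * (W - algebraMap ℂ QuasiLocal ε) =
      (2 : ℂ) • (1 : QuasiLocal) - ε • star W - star ε • W := by
    simp only [Algebra.algebraMap_eq_smul_one, star_sub, star_smul, star_one, mul_sub, sub_mul,
      hW, mul_smul_comm, smul_mul_assoc, mul_one, one_mul, smul_sub, smul_smul]
    rw [mul_comm ε, hε, two_smul, one_smul]
    abel
  rw [this, map_sub, map_sub, map_smul, map_smul, map_smul, ω.map_one, hs, h]
  simp only [smul_eq_mul]
  rw [mul_comm ε, hε]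
  norm_num

theorem State.mul_left_of_eq (ω : State) {W : QuasiLocal} (hW : star W * W = 1) {ε : ℂ}
    (hε : star ε * ε = 1) (h : ω.toFunctional W = ε) (a : QuasiLocal) :
    ω.toFunctional (a * W) = ε * ω.toFunctional a := by
  have h1 := ω.inner_gns_vec (star a) W
  have h2 := ω.inner_gns_vec (star a) 1
  rw [star_star] at h1 h2
  rw [← h1, ω.gns_vec_of_eq hW hε h, inner_smul_right]
  rw [_root_.map_one, one_apply_eq_self, mul_one] at h2
  rw [h2]

end GNS

/-! ### Products of Pauli matrices and their commutation signs -/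

/-- The character `{0, 1} → {1, -1}`. -/
noncomputable def chi (a : ZMod 2) : ℂ := if a = 0 then 1 else -1

@[simp] theorem chi_zero : chi 0 = 1 := by simp [chi]

@[simp] theorem chi_one : chi 1 = -1 := by simp [chi]

theorem zmod_two_cases (a : ZMod 2) : a = 0 ∨ a = 1 := by
  revert a
  decide

theorem chi_add (a b : ZMod 2) : chi (a + b) = chi a * chi b := by
  have h : (1 : ZMod 2) + 1 = 0 := by decide
  rcases zmod_two_cases a with rfl | rfl <;> rcases zmod_two_cases b with rfl | rfl <;> simp [h]

theorem chi_mul_self (a : ZMod 2) : chi a * chi a = 1 := by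
  rcases zmod_two_cases a with rfl | rfl <;> simp

theorem star_chi (a : ZMod 2) : star (chi a) = chi a := by
  rcases zmod_two_cases a with rfl | rfl <;> simp

theorem chi_sum (l : List (ZMod 2)) : chi l.sum = (l.map chi).prod := by
  induction l with
  | nil => simp
  | cons a l ih => simp [chi_add, ih]

/-- The other one of the two Pauli matrices. -/
def Pauli.dual : Pauli → Pauli
  | .x => .z
  | .z => .x

@[simp] theorem Pauli.dual_dual : ∀ P : Pauli, P.dual.dual = P
  | .x => rfl
  | .z => rfl

theorem Pauli.eq_or_eq_dual : ∀ P Q : Pauli, Q = P ∨ Q = P.dual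
  | .x, .x | .z, .z => Or.inl rfl
  | .x, .z | .z, .x => Or.inr rfl

theorem Pauli.dual_ne : ∀ P : Pauli, P.dual ≠ P
  | .x | .z => nofun

/-- The bonds of the star, respectively the plaquette, with the label `s`. -/
def cells : Pauli → Point → List Bond
  | .x => starBonds
  | .z => plaqBonds

/-- The product of the Pauli matrices `P` along a list of bonds. -/
noncomputable def prodL (P : Pauli) (l : List Bond) : QuasiLocal := (l.map (pauli P)).prod

/-- The star operators for `P = x`, the plaquette operators for `P = z`. -/
noncomputable def check (P : Pauli) (s : Point) : QuasiLocal := prodL P (cells P s)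

/-- The number of occurrences of a bond modulo two. -/
def par (l : List Bond) (b : Bond) : ZMod 2 := (l.count b : ZMod 2)

/-- The parity of the number of coincidences of two lists of bonds. -/
def pairing (l l' : List Bond) : ZMod 2 := (l'.map (par l)).sum

@[simp] theorem prodL_nil (P : Pauli) : prodL P [] = 1 := rfl

theorem prodL_cons (P : Pauli) (b : Bond) (l : List Bond) :
    prodL P (b :: l) = pauli P b * prodL P l := by simp [prodL]

theorem prodL_append (P : Pauli) (l l' : List Bond) :
    prodL P (l ++ l') = prodL P l * prodL P l' := by simp [prodL]

theorem prodL_singleton (P : Pauli) (b : Bond) : prodL P [b] = pauli P b := by simp [prodL]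

theorem commute_prodL (P : Pauli) (l l' : List Bond) : Commute (prodL P l) (prodL P l') := by
  refine Commute.list_prod_left _ _ fun a ha => Commute.list_prod_right _ _ fun b hb => ?_
  obtain ⟨_, -, rfl⟩ := List.mem_map.mp ha
  obtain ⟨_, -, rfl⟩ := List.mem_map.mp hb
  exact commute_pauli _ _ _

theorem star_prodL (P : Pauli) (l : List Bond) : star (prodL P l) = prodL P l := by
  induction l with
  | nil => simp
  | cons b l ih =>
    rw [prodL_cons, star_mul, ih, star_pauli, ← prodL_singleton, (commute_prodL P l [b]).eq]

theorem prodL_mul_self (P : Pauli) (l : List Bond) : prodL P l * prodL P l = 1 := by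
  induction l with
  | nil => simp
  | cons b l ih =>
    rw [← List.singleton_append, prodL_append]
    calc _ = prodL P [b] * (prodL P l * prodL P [b]) * prodL P l := by simp only [mul_assoc]
      _ = (prodL P [b] * prodL P [b]) * (prodL P l * prodL P l) := by
        rw [(commute_prodL P l [b]).eq]; simp only [mul_assoc]
      _ = 1 := by rw [ih, prodL_singleton, pauli_mul_self, one_mul]

theorem par_nil : par [] = 0 := by ext b; simp [par]

theorem par_cons (b : Bond) (l : List Bond) (b' : Bond) :
    par (b :: l) b' = par l b' + if b = b' then 1 else 0 := by
  simp only [par, List.count_cons, beq_iff_eq]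
  split_ifs <;> simp

theorem par_append (l l' : List Bond) : par (l ++ l') = par l + par l' := by
  ext b; simp [par]

theorem par_singleton (b b' : Bond) : par [b] b' = if b = b' then 1 else 0 := by
  rw [par_cons, par_nil]; simp

@[simp] theorem pairing_nil_left (l : List Bond) : pairing [] l = 0 := by
  induction l with
  | nil => rfl
  | cons b l ih => simpa [pairing, par_nil] using ih

theorem pairing_cons_right (l : List Bond) (b : Bond) (l' : List Bond) :
    pairing l (b :: l') = par l b + pairing l l' := by simp [pairing]

theorem pairing_append_left (l₁ l₂ l : List Bond) :
    pairing (l₁ ++ l₂) l = pairing l₁ l + pairing l₂ l := by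
  induction l with
  | nil => simp [pairing]
  | cons b l ih => simp only [pairing_cons_right, ih, par_append, Pi.add_apply]; ring

theorem pairing_singleton_left (b : Bond) (l : List Bond) : pairing [b] l = par l b := by
  induction l with
  | nil => simp [pairing, par]
  | cons b' l ih =>
    rw [pairing_cons_right, ih, par_cons b', par_singleton, add_comm]
    simp only [eq_comm]

theorem pairing_comm (l l' : List Bond) : pairing l l' = pairing l' l := by
  induction l' with
  | nil => rw [pairing_nil_left]; rfl
  | cons b l' ih =>
    rw [pairing_cons_right, ih, ← List.singleton_append, pairing_append_left,
      pairing_singleton_left]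

theorem prodL_x_mul_z (l l' : List Bond) :
    prodL .x l * prodL .z l' = chi (pairing l l') • (prodL .z l' * prodL .x l) := by
  have h : ∀ b', (l.map fun b => if b = b' then (-1 : ℂ) else 1).prod = chi (par l b') := by
    intro b'
    induction l with
    | nil => simp [par_nil]
    | cons b l ih =>
      rw [List.map_cons, List.prod_cons, ih, par_cons, chi_add, mul_comm]
      split_ifs <;> simp
  have := prod_x_mul_prod_z l l'
  simp only [h] at this
  rw [pairing, chi_sum, List.map_map]
  exact this

/-- Each coincidence of a bond of `l` with a bond of `l'` costs one factor `-1`. Since `pairing` is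
symmetric and the sign squares to `1`, the case of `z` is the case of `x` read backwards. -/
theorem prodL_mul_dual (P : Pauli) (l l' : List Bond) :
    prodL P l * prodL P.dual l' = chi (pairing l l') • (prodL P.dual l' * prodL P l) := by
  cases P with
  | x => exact prodL_x_mul_z l l'
  | z =>
    change prodL .z l * prodL .x l' = chi (pairing l l') • (prodL .x l' * prodL .z l)
    rw [prodL_x_mul_z, smul_smul, pairing_comm, chi_mul_self, one_smul]

/-! ### Incidence of bonds with stars and plaquettes -/

theorem nodup_cells (P : Pauli) (s : Point) : (cells P s).Nodup := by
  cases P <;> simp [cells, starBonds, plaqBonds]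
  omega

theorem par_cells (P : Pauli) (s : Point) (b : Bond) :
    par (cells P s) b = if b ∈ cells P s then 1 else 0 := by
  rw [par]
  split_ifs with h
  · rw [List.count_eq_one_of_mem (nodup_cells P s) h, Nat.cast_one]
  · rw [List.count_eq_zero_of_not_mem h, Nat.cast_zero]

/-- The two stars, respectively plaquettes, that contain a bond. -/
def sides : Pauli → Bond → Point × Point
  | .x, .hor i j => ((i, j), (i + 1, j))
  | .x, .ver i j => ((i, j), (i, j + 1))
  | .z, .hor i j => ((i, j), (i, j - 1))
  | .z, .ver i j => ((i, j), (i - 1, j))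

theorem mem_cells (P : Pauli) (s : Point) (b : Bond) :
    b ∈ cells P s ↔ s = (sides P b).1 ∨ s = (sides P b).2 := by
  obtain ⟨i, j⟩ := s
  cases P <;> cases b <;>
    simp only [cells, sides, starBonds, plaqBonds, List.mem_cons, Bond.hor.injEq, Bond.ver.injEq,
      reduceCtorEq, List.not_mem_nil, or_false, false_or, Prod.mk.injEq] <;> omega

theorem sides_ne (P : Pauli) (b : Bond) : (sides P b).1 ≠ (sides P b).2 := by
  cases P <;> cases b <;> simp [sides] <;> omega

/-- A cell has several bonds in common with itself, so a single common bond rules out equal labels.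
-/
theorem MeetIn.ne {P : Pauli} {s s' : Point} {b : Bond}
    (h : MeetIn (cells P s) (cells P s') b) : s ≠ s' := by
  rintro rfl
  obtain ⟨b₁, h₁, b₂, h₂, hne⟩ : ∃ b₁ ∈ cells P s, ∃ b₂ ∈ cells P s, b₁ ≠ b₂ := by
    cases P
    · exact ⟨.hor s.1 s.2, by simp [cells, starBonds], .ver s.1 s.2, by simp [cells, starBonds],
        nofun⟩
    · exact ⟨.hor s.1 s.2, by simp [cells, plaqBonds], .ver s.1 s.2, by simp [cells, plaqBonds],
        nofun⟩
  exact hne (((h b₁).mp ⟨h₁, h₁⟩).trans ((h b₂).mp ⟨h₂, h₂⟩).symm)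

/-- A bond lies in exactly two cells of each kind, so two distinct cells that contain it are all of
them. This spares a case distinction over the directions of a step. -/
theorem MeetIn.mem_iff {P : Pauli} {s s' : Point} {b : Bond}
    (h : MeetIn (cells P s) (cells P s') b) (t : Point) : b ∈ cells P t ↔ t = s ∨ t = s' := by
  have hne := h.ne
  obtain ⟨h1, h2⟩ := (h b).mpr rfl
  rw [mem_cells] at h1 h2 ⊢
  rcases h1 with h1 | h1 <;> rcases h2 with h2 | h2
  · exact absurd (h1.trans h2.symm) hne
  · rw [h1, h2]
  · rw [h1, h2, or_comm]
  · exact absurd (h1.trans h2.symm) hne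

/-- The indicator function of an optional site. -/
def ind (o : Option Point) (s : Point) : ZMod 2 := if o = some s then 1 else 0

theorem ind_add_ind {s s' : Point} (h : s ≠ s') (t : Point) :
    ind (some s) t + ind (some s') t = if t = s ∨ t = s' then 1 else 0 := by
  simp only [ind, Option.some.injEq, @eq_comm _ t]
  by_cases h1 : s = t
  · subst h1
    simp [h.symm]
  · simp [h1]

theorem par_cells_eq_ind (P : Pauli) (b : Bond) (t : Point) :
    par (cells P t) b = ind (some (sides P b).1) t + ind (some (sides P b).2) t := by
  simp only [par_cells, mem_cells, ind_add_ind (sides_ne P b)]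

theorem MeetIn.par_eq {P : Pauli} {s s' : Point} {b : Bond}
    (h : MeetIn (cells P s) (cells P s') b) (t : Point) :
    par (cells P t) b = ind (some s) t + ind (some s') t := by
  simp only [par_cells, h.mem_iff, ind_add_ind h.ne]

/-! ### Signs of the checks and charges of paths -/

/-- A state in which the checks have the value `-1` at the sites `q P` and the value `1`
elsewhere. -/
def State.HasSigns (ω : State) (q : Pauli → Option Point) : Prop :=
  ∀ P s, ω.toFunctional (check P s) = chi (ind (q P) s)

theorem State.IsGroundState.hasSigns {ω : State} (h : ω.IsGroundState) :
    ω.HasSigns fun _ => none := by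
  intro P s
  cases P
  · exact (h.1 s).trans (by simp [ind])
  · exact (h.2 s).trans (by simp [ind])

/-- The map `α` changes the checks by the signs `chi (f P s)`. -/
def Twists (α : QuasiLocal → QuasiLocal) (f : Pauli → Point → ZMod 2) : Prop :=
  ∀ P s, α (check P s) = chi (f P s) • check P s

theorem Twists.hasSigns {ω : State} {q q' : Pauli → Option Point} (hω : ω.HasSigns q)
    {α : QuasiLocal →⋆ₐ[ℂ] QuasiLocal} (h : Twists α fun P s => ind (q P) s + ind (q' P) s) :
    (ω.comp α).HasSigns q' := by
  intro P s
  have h2 : ∀ a b : ZMod 2, a + b + a = b := by decide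
  rw [State.comp_apply, h P s, map_smul, hω P s, smul_eq_mul, ← chi_add, h2]

theorem Twists.comp {α β : QuasiLocal →⋆ₐ[ℂ] QuasiLocal} {f g : Pauli → Point → ZMod 2}
    (h : Twists α f) (h' : Twists β g) : Twists (α.comp β) (f + g) := fun P s => by
  rw [StarAlgHom.comp_apply, h' P s, map_smul, h P s, smul_smul, ← chi_add, add_comm]
  rfl

instance : DecidableEq Pauli
  | .x, .x => isTrue rfl
  | .z, .z => isTrue rfl
  | .x, .z => isFalse nofun
  | .z, .x => isFalse nofun

/-- The signs by which conjugation with a single Pauli matrix changes the checks. -/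
def letterTwist (w : Pauli × Bond) (P : Pauli) (s : Point) : ZMod 2 :=
  if w.1 = P.dual then par (cells P s) w.2 else 0

theorem twists_letter (w : Pauli × Bond) :
    Twists (fun a => pauli w.1 w.2 * a * pauli w.1 w.2) (letterTwist w) := by
  intro P s
  obtain ⟨Q, b⟩ := w
  rw [letterTwist]
  dsimp only
  rcases P.eq_or_eq_dual Q with rfl | rfl
  · rw [if_neg (Pauli.dual_ne Q).symm, chi_zero, one_smul, check, ← prodL_singleton,
      (commute_prodL Q [b] _).eq, mul_assoc, prodL_mul_self, mul_one]
  · rw [if_pos rfl, check, ← prodL_singleton, mul_assoc, prodL_mul_dual, mul_smul_comm, ← mul_assoc,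
      prodL_mul_self, one_mul, pairing_comm, pairing_singleton_left]

/-- The stars and plaquettes that are excited when there is an excitation of type `k` at the site
`x`. -/
def charge : (k : Kind) → Site k → Pauli → Option Point
  | .X, _, .x => none
  | .X, p, .z => some p
  | .Z, v, .x => some v
  | .Z, _, .z => none
  | .Y, s, .x => some s.1.1
  | .Y, s, .z => some s.1.2

theorem zmod_two_add_self (a : ZMod 2) : a + a = 0 := by
  revert a
  decide

/-- The bond of a step lies in exactly the two cells between which the step moves. For the kind of
check whose site stays fixed, the two indicators coincide and cancel modulo two. -/
theorem Step.letterTwist_eq : ∀ {k : Kind} {x x' : Site k} {w : Pauli × Bond}, Step k x x' w →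
    ∀ P s, letterTwist w P s = ind (charge k x P) s + ind (charge k x' P) s
  | .X, _, _, (_, _), ⟨rfl, _⟩, .x, _ => rfl
  | .X, _, _, (_, _), ⟨rfl, h⟩, .z, s => h.par_eq (P := .z) s
  | .Z, _, _, (_, _), ⟨rfl, _⟩, .z, _ => rfl
  | .Z, _, _, (_, _), ⟨rfl, h⟩, .x, s => h.par_eq (P := .x) s
  | .Y, _, _, (_, _), .inl ⟨_, rfl, h⟩, .x, s => h.par_eq (P := .x) s
  | .Y, x, _, (_, _), .inl ⟨e, rfl, _⟩, .z, s =>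
    (zmod_two_add_self (ind (some x.1.2) s)).symm.trans
      (congrArg (fun p => ind (some x.1.2) s + ind (some p) s) e)
  | .Y, _, _, (_, _), .inr ⟨_, rfl, h⟩, .z, s => h.par_eq (P := .z) s
  | .Y, x, _, (_, _), .inr ⟨e, rfl, _⟩, .x, s =>
    (zmod_two_add_self (ind (some x.1.1) s)).symm.trans
      (congrArg (fun p => ind (some x.1.1) s + ind (some p) s) e)

theorem adString_succ' (w : ℕ → Pauli × Bond) (n : ℕ) (a : QuasiLocal) :
    adString w (n + 1) a =
      adString w n (pauli (w n).1 (w n).2 * a * pauli (w n).1 (w n).2) := by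
  simp only [adString, stringOp, star_mul, star_pauli, mul_assoc]

theorem adString_smul (w : ℕ → Pauli × Bond) (n : ℕ) (r : ℂ) (a : QuasiLocal) :
    adString w n (r • a) = r • adString w n a := by
  simp [adString]

/-- The signs of the steps telescope: every intermediate site is the end of one step and the start
of the next. -/
theorem InfinitePath.twists_adString {k : Kind} {x : Site k} (γ : InfinitePath k x) (n : ℕ) :
    Twists (adString γ.letter n)
      fun P s => ind (charge k x P) s + ind (charge k (γ.site n) P) s := by
  intro P s
  induction n with
  | zero =>
    simp only [γ.site_zero, zmod_two_add_self, chi_zero, one_smul]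
    simp [adString, stringOp]
  | succ n ih =>
    have h : ∀ a b c : ZMod 2, b + c + (a + b) = a + c := by decide
    have e : pauli (γ.letter n).1 (γ.letter n).2 * check P s * pauli (γ.letter n).1 (γ.letter n).2 =
      _ := twists_letter (γ.letter n) P s
    rw [adString_succ', e, adString_smul, ih, smul_smul,
      (γ.step n).letterTwist_eq, ← chi_add, h]

/-- The bond `.hor s.1 s.2` belongs both to the star and to the plaquette with label `s`, so one
bond serves for both kinds of charge. -/
theorem mem_near_of_charge : ∀ {k : Kind} {x : Site k} {P : Pauli} {s : Point},
    charge k x P = some s → x ∈ Site.near (.hor s.1 s.2) k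
  | .X, _, .z, _, rfl => by simp [Site.near, plaqBonds]
  | .Z, _, .x, _, rfl => by simp [Site.near, starBonds]
  | .Y, _, .x, _, rfl => by simp [Site.near, starBonds]
  | .Y, _, .z, _, rfl => by simp [Site.near, plaqBonds]

theorem InfinitePath.eventually_ind {k : Kind} {x : Site k} (γ : InfinitePath k x) (P : Pauli)
    (s : Point) : ∀ᶠ n in atTop, ind (charge k (γ.site n) P) s = 0 := by
  filter_upwards [γ.tendsto_site (Site.finite_near (.hor s.1 s.2) k).compl_mem_cofinite] with n hn
  exact if_neg fun h => hn (mem_near_of_charge h)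

/-- The moving end of the path leaves every finite set, so from some step on it no longer affects a
given check and only the starting site contributes. -/
theorem InfinitePath.twists_endo {k : Kind} {x : Site k} (γ : InfinitePath k x) :
    Twists γ.endo fun P s => ind (charge k x P) s := by
  intro P s
  refine tendsto_nhds_unique (tendsto_limString γ.locallyFinite _)
    (tendsto_const_nhds.congr' ?_)
  filter_upwards [γ.eventually_ind P s] with n hn
  rw [γ.twists_adString n P s]
  simp only [hn, add_zero]

theorem State.hasSigns_excite {ω₀ : State} (h : ω₀.HasSigns fun _ => none) {k : Kind} {x : Site k}
    (γ : InfinitePath k x) : (ω₀.excite γ).HasSigns (charge k x) := by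
  refine Twists.hasSigns h fun P s => ?_
  rw [γ.twists_endo P s]
  simp [ind]

/-- The excited stars and plaquettes of the types `0, X, Y, Z`. -/
def hasCharge : Option Kind → Pauli → Bool
  | none, _ => false
  | some .X, .x => false
  | some .X, .z => true
  | some .Z, .x => true
  | some .Z, .z => false
  | some .Y, _ => true

theorem isSome_charge : ∀ (k : Kind) (x : Site k) (P : Pauli),
    (charge k x P).isSome = hasCharge (some k) P
  | .X, _, .x | .X, _, .z | .Y, _, .x | .Y, _, .z | .Z, _, .x | .Z, _, .z => rfl

theorem hasCharge_injective : Function.Injective hasCharge := by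
  intro k l h
  have h1 := congrFun h .x
  have h2 := congrFun h .z
  rcases k with _ | _ | _ | _ <;> rcases l with _ | _ | _ | _ <;>
    first | rfl | exact absurd h1 (by decide) | exact absurd h2 (by decide)

/-- Only the presence of each of the two charges is kept from the type; where they sit is irrelevant
up to equivalence. -/
theorem State.HasType.exists_hasSigns {ω₀ ω : State} (h : ω₀.HasSigns fun _ => none)
    {k : Option Kind} (hω : ω₀.HasType k ω) :
    ∃ q, ω.HasSigns q ∧ ∀ P, (q P).isSome = hasCharge k P := by
  cases hω with
  | ground => exact ⟨_, h, fun P => rfl⟩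
  | excited γ => exact ⟨_, State.hasSigns_excite h γ, fun P => isSome_charge _ _ P⟩

/-! ### Vanishing of the first homology of the lattice -/

theorem prodL_perm (P : Pauli) {l l' : List Bond} (h : l.Perm l') : prodL P l = prodL P l' := by
  refine (h.map (pauli P)).prod_eq' (List.pairwise_map.mpr ?_)
  exact List.pairwise_of_forall fun b b' => commute_pauli P b b'

/-- Factors of one kind commute and square to `1`. An even count provides a second copy of the first
bond, the pair cancels, and induction on the length applies. -/
theorem prodL_eq_one (P : Pauli) {l : List Bond} (h : par l = 0) : prodL P l = 1 := by
  induction hn : l.length using Nat.strong_induction_on generalizing l with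
  | _ n ih =>
    cases l with
    | nil => rfl
    | cons b l =>
      have h1 := congrFun h b
      rw [par_cons, if_pos rfl] at h1
      have hb : b ∈ l := by
        by_contra hb
        rw [par, List.count_eq_zero_of_not_mem hb] at h1
        simp at h1
      have hp := List.perm_cons_erase hb
      rw [prodL_cons, prodL_perm P hp, prodL_cons, ← mul_assoc, pauli_mul_self, one_mul]
      refine ih _ ?_ ?_ rfl
      · rw [← hn, List.length_cons]
        exact Nat.lt_succ_of_le List.length_erase_le
      · ext b'
        have h2 := congrFun h b'
        have h3 : par l = par (b :: l.erase b) := by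
          ext b'
          rw [par, par, hp.count_eq]
        rw [par_cons, h3, par_cons, add_assoc, zmod_two_add_self, add_zero] at h2
        exact h2

theorem prodL_congr (P : Pauli) {l l' : List Bond} (h : par l = par l') :
    prodL P l = prodL P l' := by
  have h1 : prodL P (l ++ l') = 1 := prodL_eq_one P (by
    rw [par_append, h]
    ext b
    exact zmod_two_add_self _)
  rw [prodL_append] at h1
  calc prodL P l = prodL P l * (prodL P l' * prodL P l') := by rw [prodL_mul_self, mul_one]
    _ = prodL P l' := by rw [← mul_assoc, h1, one_mul]

/-- The parity of the number of vertical bonds of `l` to the left of the plaquette `p`. -/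
def potential (l : List Bond) (p : Point) : ZMod 2 :=
  (l.map fun b => match b with
    | .hor _ _ => (0 : ZMod 2)
    | .ver i j => if i ≤ p.1 ∧ j = p.2 then 1 else 0).sum

theorem potential_add (l : List Bond) (i j : ℤ) :
    potential l (i, j) + potential l (i - 1, j) = par l (.ver i j) := by
  induction l with
  | nil => simp [potential, par]
  | cons b l ih =>
    have h : ∀ x y a b : ZMod 2, x + a + (y + b) = (a + b) + (x + y) := fun _ _ _ _ => by ring
    simp only [potential, List.map_cons, List.sum_cons] at ih ⊢
    rw [h, ih, par_cons]
    congr 1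
    cases b with
    | hor a b => simp
    | ver a b =>
      have h2 : (1 : ZMod 2) + 1 = 0 := by decide
      simp only [Bond.ver.injEq]
      by_cases hb : b = j
      · rcases lt_trichotomy a i with ha | ha | ha
        · rw [if_pos ⟨ha.le, hb⟩, if_pos ⟨by omega, hb⟩, if_neg (by omega), h2]
        · rw [if_pos ⟨ha.le, hb⟩, if_neg (by omega), if_pos ⟨ha, hb⟩, add_zero]
        · rw [if_neg (by omega), if_neg (by omega), if_neg (by omega), add_zero]
      · simp [hb]

theorem potential_eq_zero {l : List Bond} {p : Point}
    (h : ∀ i j, .ver i j ∈ l → i ≤ p.1 → j ≠ p.2) : potential l p = 0 := by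
  refine List.sum_eq_zero fun x hx => ?_
  obtain ⟨b, hb, rfl⟩ := List.mem_map.mp hx
  cases b with
  | hor i j => rfl
  | ver i j => exact if_neg fun hc => h i j hb hc.1 hc.2

/-- The codomain is arbitrary because this also serves for a map into the quotient by `moveSetoid`.
-/
theorem eq_of_forall_add_one {β : Type*} {g : ℤ → β} (h : ∀ i, g (i + 1) = g i) (i k : ℤ) :
    g i = g k := by
  have h0 : ∀ i, g i = g 0 := fun i => by
    induction i using Int.induction_on with
    | zero => rfl
    | succ n ih => rw [h, ih]
    | pred n ih => rw [← ih, ← h (-n - 1), sub_add_cancel]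
  rw [h0 i, h0 k]

theorem exists_bound (l : List Bond) : ∃ M : ℤ, ∀ i j, (.hor i j ∈ l ∨ .ver i j ∈ l) →
    -M < i ∧ i < M ∧ -M < j ∧ j < M := by
  induction l with
  | nil => exact ⟨0, by simp⟩
  | cons b l ih =>
    obtain ⟨M, hM⟩ := ih
    obtain ⟨a, c, hb⟩ : ∃ a c, b = .hor a c ∨ b = .ver a c := by
      cases b with
      | hor a c => exact ⟨a, c, Or.inl rfl⟩
      | ver a c => exact ⟨a, c, Or.inr rfl⟩
    have h1 := le_abs_self a
    have h2 := neg_abs_le a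
    have h3 := le_abs_self c
    have h4 := neg_abs_le c
    refine ⟨|M| + |a| + |c| + 1, fun i j hij => ?_⟩
    have h5 := le_abs_self M
    have : (i = a ∧ j = c) ∨ (.hor i j ∈ l ∨ .ver i j ∈ l) := by
      rcases hb with rfl | rfl <;>
        simp only [List.mem_cons, Bond.hor.injEq, Bond.ver.injEq, reduceCtorEq, false_or] at hij <;>
        tauto
    rcases this with ⟨rfl, rfl⟩ | this
    · have := abs_nonneg M
      omega
    · have := hM i j this
      omega

theorem par_eq_zero {l : List Bond} {b : Bond} (h : b ∉ l) : par l b = 0 := by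
  rw [par, List.count_eq_zero_of_not_mem h, Nat.cast_zero]

/-- The first homology of the square lattice vanishes: a finite chain of bonds without boundary is
the boundary of a finite set of plaquettes. -/
theorem exists_potential_star {l : List Bond} (h : ∀ s, pairing l (starBonds s) = 0) :
    ∃ f : Point → ZMod 2, {p | f p ≠ 0}.Finite ∧
      ∀ b, par l b = f (sides .z b).1 + f (sides .z b).2 := by
  obtain ⟨M, hM⟩ := exists_bound l
  -- The potential counts crossings of the leftward ray in a row of plaquettes. Across vertical
  -- bonds it works for every chain; the absence of boundary is needed for the horizontal ones.
  have hver : ∀ i j, potential l (i, j) + potential l (i - 1, j) = par l (.ver i j) :=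
    potential_add l
  have hleft : ∀ i j, i ≤ -M → potential l (i, j) = 0 := fun i j hi =>
    potential_eq_zero fun a c hac ha => by
      have := hM a c (Or.inr hac)
      dsimp only at ha
      omega
  have hout : ∀ i j, (j ≤ -M ∨ M ≤ j) → potential l (i, j) = 0 := fun i j hj =>
    potential_eq_zero fun a c hac ha => by
      have := hM a c (Or.inr hac)
      dsimp only at ha ⊢
      omega
  have hhor : ∀ i j, potential l (i, j) + potential l (i, j - 1) = par l (.hor i j) := by
    intro i j
    have key : ∀ a a' b b' x y : ZMod 2, a + a' + b + b' + (x + y) = 0 →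
      a + b + x = a' + b' + y := by decide
    -- The boundary condition at the vertex `(i + 1, j)` says that the defect of the desired
    -- identity does not change from `i` to `i + 1`. It vanishes at `i = -M`, since the bounds of
    -- `exists_bound` are strict.
    have hconst : ∀ i, potential l (i + 1, j) + potential l (i + 1, j - 1) +
        par l (.hor (i + 1) j) = potential l (i, j) + potential l (i, j - 1) + par l (.hor i j) := by
      intro i
      have h1 := h (i + 1, j)
      have h2 := hver (i + 1) j
      have h3 := hver (i + 1) (j - 1)
      simp only [add_sub_cancel_right] at h2 h3
      simp only [pairing, starBonds, List.map_cons, List.map_nil, List.sum_cons, List.sum_nil,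
        add_sub_cancel_right, add_zero, ← h2, ← h3] at h1
      apply key
      rw [← h1]
      ring
    have h0 := eq_of_forall_add_one (g := fun i => potential l (i, j) + potential l (i, j - 1) +
      par l (.hor i j)) hconst i (-M)
    rw [hleft _ _ le_rfl, hleft _ _ le_rfl, par_eq_zero (b := .hor (-M) j)
      (fun hc => by have := hM _ _ (Or.inl hc); omega)] at h0
    have : ∀ a b c : ZMod 2, a + b + c = 0 + 0 + 0 → a + b = c := by decide
    exact this _ _ _ h0
  -- This is what makes the support finite. To the right of the chain there are no horizontal bonds,
  -- so `hhor` makes the potential constant along columns, and it vanishes at height `M`.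
  have hright : ∀ i j, M ≤ i → potential l (i, j) = 0 := by
    intro i j hi
    have : ∀ j, potential l (i, j + 1) = potential l (i, j) := fun j => by
      have h1 := hhor i (j + 1)
      rw [par_eq_zero (fun hc => by have := hM _ _ (Or.inl hc); omega), add_sub_cancel_right] at h1
      have : ∀ a b : ZMod 2, a + b = 0 → a = b := by decide
      exact this _ _ h1
    rw [eq_of_forall_add_one (g := fun j => potential l (i, j)) this j M]
    exact hout _ _ (Or.inr le_rfl)
  refine ⟨potential l, ((Set.finite_Icc (-M) M).prod (Set.finite_Icc (-M) M)).subset ?_, ?_⟩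
  · rintro ⟨i, j⟩ hp
    by_contra hc
    simp only [Set.mem_prod, Set.mem_Icc] at hc
    refine hp ?_
    by_cases h1 : i ≤ -M
    · exact hleft i j h1
    by_cases h2 : M ≤ i
    · exact hright i j h2
    exact hout i j (by omega)
  · rintro (⟨i, j⟩ | ⟨i, j⟩)
    · exact (hhor i j).symm
    · exact (hver i j).symm

/-- The identification of the lattice with its dual lattice. -/
def Bond.swap : Bond → Bond
  | .hor i j => .ver (-i) (-j)
  | .ver i j => .hor (-i) (-j)

theorem Bond.swap_swap (b : Bond) : b.swap.swap = b := by
  cases b <;> simp [Bond.swap]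

theorem par_map_swap (l : List Bond) (b : Bond) : par (l.map Bond.swap) b = par l b.swap := by
  rw [par, par, ← List.count_map_of_injective l _
    (Function.LeftInverse.injective Bond.swap_swap), Bond.swap_swap]

/-- The map `Bond.swap` takes the star at `s` to the plaquette at `-s`, which reduces the case of
`z` to that of `x`. The reflection is needed because a star reaches back to `s - 1` while a
plaquette reaches forward to `p + 1`. -/
theorem exists_potential (P : Pauli) {l : List Bond} (h : ∀ s, pairing l (cells P s) = 0) :
    ∃ f : Point → ZMod 2, {p | f p ≠ 0}.Finite ∧
      ∀ b, par l b = f (sides P.dual b).1 + f (sides P.dual b).2 := by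
  cases P with
  | x => exact exists_potential_star h
  | z =>
    obtain ⟨f, hf, hb⟩ := exists_potential_star (l := l.map Bond.swap) fun s => by
      rw [← h (-s)]
      simp only [pairing, cells, starBonds, plaqBonds, List.map_cons, List.map_nil, List.sum_cons,
        List.sum_nil, par_map_swap, Bond.swap, Prod.fst_neg, Prod.snd_neg, neg_sub', sub_neg_eq_add]
      ring
    refine ⟨fun s => f (-s), hf.preimage neg_injective.injOn, fun b => ?_⟩
    rw [← b.swap_swap, ← par_map_swap, hb, b.swap_swap]
    cases b <;> simp [sides, Bond.swap, Pauli.dual, sub_eq_add_neg, add_comm]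

theorem par_flatMap (P : Pauli) (F : List Point) (b : Bond) :
    par (F.flatMap (cells P)) b = (F.map fun s => par (cells P s) b).sum := by
  induction F with
  | nil => simp [par_nil]
  | cons s F ih => simp [par_append, ih]

/-- `F` lists the support of the potential: a bond is counted once for each of its two sides in the
support. -/
theorem exists_par_eq (P : Pauli) {l : List Bond} (h : ∀ s, pairing l (cells P s) = 0) :
    ∃ F : List Point, par l = par (F.flatMap (cells P.dual)) := by
  obtain ⟨f, hf, hb⟩ := exists_potential P h
  refine ⟨hf.toFinset.toList, funext fun b => ?_⟩
  have hone : ∀ s, f s = if f s ≠ 0 then 1 else 0 := fun s => by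
    rcases zmod_two_cases (f s) with h | h <;> simp [h]
  rw [hb, par_flatMap, Finset.sum_map_toList]
  simp only [par_cells_eq_ind, ind, Option.some.injEq, Finset.sum_add_distrib, Finset.sum_ite_eq,
    Set.Finite.mem_toFinset, Set.mem_ofPred_eq]
  rw [← hone, ← hone]

/-! ### Uniqueness of the state with given signs -/

theorem star_check (P : Pauli) (s : Point) : star (check P s) = check P s := star_prodL _ _

theorem check_mul_self (P : Pauli) (s : Point) : check P s * check P s = 1 := prodL_mul_self _ _

theorem State.HasSigns.mul_check {ω : State} {q : Pauli → Option Point} (h : ω.HasSigns q)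
    (P : Pauli) (s : Point) (a : QuasiLocal) :
    ω.toFunctional (a * check P s) = chi (ind (q P) s) * ω.toFunctional a :=
  ω.mul_left_of_eq (by rw [star_check, check_mul_self]) (by rw [star_chi, chi_mul_self]) (h P s) a

theorem State.HasSigns.check_mul {ω : State} {q : Pauli → Option Point} (h : ω.HasSigns q)
    (P : Pauli) (s : Point) (a : QuasiLocal) :
    ω.toFunctional (check P s * a) = chi (ind (q P) s) * ω.toFunctional a := by
  -- The adjoint of the version with the check on the right; checks are self-adjoint and the signs
  -- are real.
  have := congrArg star (h.mul_check P s (star a))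
  rwa [← map_star, star_mul, star_mul', star_chi, star_star, star_check, ← map_star,
    star_star] at this

/-- A check acts in the state as the same sign from the left and from the right, so anticommutation
forces the expectation to equal its negative. -/
theorem State.HasSigns.eq_zero {ω : State} {q : Pauli → Option Point} (h : ω.HasSigns q)
    {P : Pauli} {s : Point} {a : QuasiLocal} (ha : a * check P s = -(check P s * a)) :
    ω.toFunctional a = 0 := by
  have h1 := congrArg ω.toFunctional ha
  rw [map_neg, h.mul_check, h.check_mul] at h1
  have h2 := chi_mul_self (ind (q P) s)
  linear_combination (chi (ind (q P) s) / 2) * h1 - ω.toFunctional a * h2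

theorem State.HasSigns.mul_prodL {ω : State} {q : Pauli → Option Point} (h : ω.HasSigns q)
    (P : Pauli) (F : List Point) (a : QuasiLocal) :
    ω.toFunctional (a * prodL P (F.flatMap (cells P))) =
      (F.map fun s => chi (ind (q P) s)).prod * ω.toFunctional a := by
  induction F generalizing a with
  | nil => simp
  | cons s F ih =>
    rw [List.flatMap_cons, prodL_append, ← mul_assoc, ih, List.map_cons, List.prod_cons]
    change _ * ω.toFunctional (a * check P s) = _
    rw [h.mul_check]
    ring

/-- If `l` or `l'` meets some check of the other kind in an odd number of bonds, the monomial
anticommutes with that check and both values are `0`. Otherwise both factors are products of checks,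
whose values depend on `q` alone. -/
theorem State.HasSigns.eq_monomial {ω ω' : State} {q : Pauli → Option Point} (h : ω.HasSigns q)
    (h' : ω'.HasSigns q) (l l' : List Bond) :
    ω.toFunctional (prodL .x l * prodL .z l') = ω'.toFunctional (prodL .x l * prodL .z l') := by
  by_cases h1 : ∀ s, pairing l (cells .z s) = 0
  · by_cases h2 : ∀ s, pairing l' (cells .x s) = 0
    · obtain ⟨F, hF⟩ := exists_par_eq _ h1
      obtain ⟨F', hF'⟩ := exists_par_eq _ h2
      -- The factor `1` provides the left factor that `mul_prodL` expects at its second use.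
      have e1 : prodL .x l = 1 * prodL .x (F.flatMap (cells .x)) := by
        rw [one_mul]
        exact prodL_congr _ hF
      have e2 : prodL .z l' = prodL .z (F'.flatMap (cells .z)) := prodL_congr _ hF'
      rw [e1, e2, h.mul_prodL, h.mul_prodL, h'.mul_prodL, h'.mul_prodL, ω.map_one, ω'.map_one]
    · push Not at h2
      obtain ⟨s, hs⟩ := h2
      replace hs := (zmod_two_cases _).resolve_left hs
      have : prodL .x l * prodL .z l' * check .x s = -(check .x s * (prodL .x l * prodL .z l')) := by
        have e := prodL_mul_dual .z l' (cells .x s)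
        rw [hs, chi_one, neg_one_smul] at e
        change prodL .z l' * prodL .x _ = -(prodL .x _ * _) at e
        rw [check, mul_assoc, e, mul_neg, ← mul_assoc, (commute_prodL _ _ _).eq, mul_assoc]
      rw [h.eq_zero this, h'.eq_zero this]
  · push Not at h1
    obtain ⟨s, hs⟩ := h1
    replace hs := (zmod_two_cases _).resolve_left hs
    have : prodL .x l * prodL .z l' * check .z s = -(check .z s * (prodL .x l * prodL .z l')) := by
      have e := prodL_mul_dual .x l (cells .z s)
      rw [hs, chi_one, neg_one_smul] at e
      change prodL .x l * prodL .z _ = -(prodL .z _ * _) at e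
      rw [check, mul_assoc, (commute_prodL _ _ _).eq, ← mul_assoc, e, neg_mul, mul_assoc]
    rw [h.eq_zero this, h'.eq_zero this]

/-- The linear span of the products of Pauli matrices. -/
noncomputable def pauliSpan : Submodule ℂ QuasiLocal :=
  Submodule.span ℂ {a | ∃ l l', a = prodL .x l * prodL .z l'}

theorem pauli_mul_mem_pauliSpan (P : Pauli) (b : Bond) {a : QuasiLocal} (ha : a ∈ pauliSpan) :
    pauli P b * a ∈ pauliSpan := by
  induction ha using Submodule.span_induction with
  | mem a h =>
    obtain ⟨l, l', rfl⟩ := h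
    cases P with
    | x =>
      refine Submodule.subset_span ⟨b :: l, l', ?_⟩
      rw [prodL_cons, mul_assoc]
    | z =>
      have : pauli .z b * (prodL .x l * prodL .z l') =
          chi (pairing [b] l) • (prodL .x l * prodL .z (b :: l')) := by
        have e : prodL .z [b] * prodL .x l = chi (pairing [b] l) • (prodL .x l * prodL .z [b]) :=
          prodL_mul_dual .z [b] l
        rw [prodL_singleton] at e
        rw [← mul_assoc, e, smul_mul_assoc, prodL_cons, mul_assoc]
      rw [this]
      exact Submodule.smul_mem _ _ (Submodule.subset_span ⟨_, _, rfl⟩)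
  | zero => rw [mul_zero]; exact zero_mem _
  | add a b _ _ h h' => rw [mul_add]; exact add_mem h h'
  | smul r a _ h => rw [mul_smul_comm]; exact Submodule.smul_mem _ _ h

/-- The expansion of a matrix in the basis `1, σˣ, σᶻ, σˣσᶻ` of the two-by-two matrices. -/
theorem obs_eq (b : Bond) (m : Matrix (Fin 2) (Fin 2) ℂ) :
    obs b m = ((m 0 0 + m 1 1) / 2) • 1 + ((m 0 1 + m 1 0) / 2) • pauli .x b +
      ((m 0 0 - m 1 1) / 2) • pauli .z b +
      ((m 1 0 - m 0 1) / 2) • (pauli .x b * pauli .z b) := by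
  rw [pauli, pauli, ← map_mul, ← map_one (obs b), ← map_smul, ← map_smul, ← map_smul, ← map_smul,
    ← map_add, ← map_add, ← map_add]
  congr 1
  ext i j
  fin_cases i <;> fin_cases j <;> simp [Pauli.matrix] <;> ring

theorem obs_mul_mem_pauliSpan (b : Bond) (m : Matrix (Fin 2) (Fin 2) ℂ) {a : QuasiLocal}
    (ha : a ∈ pauliSpan) : obs b m * a ∈ pauliSpan := by
  rw [obs_eq, add_mul, add_mul, add_mul, smul_mul_assoc, smul_mul_assoc, smul_mul_assoc,
    smul_mul_assoc, one_mul, mul_assoc]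
  exact add_mem (add_mem (add_mem (Submodule.smul_mem _ _ ha)
    (Submodule.smul_mem _ _ (pauli_mul_mem_pauliSpan _ _ ha)))
    (Submodule.smul_mem _ _ (pauli_mul_mem_pauliSpan _ _ ha)))
    (Submodule.smul_mem _ _ (pauli_mul_mem_pauliSpan _ _ (pauli_mul_mem_pauliSpan _ _ ha)))

theorem localObs_le_pauliSpan {a : QuasiLocal} (ha : a ∈ localObs Set.univ) : a ∈ pauliSpan := by
  -- Carrying `a` and `star a` together makes the adjoint case of the induction a mere exchange of
  -- the two halves.
  have h : (∀ c ∈ pauliSpan, a * c ∈ pauliSpan) ∧ ∀ c ∈ pauliSpan, star a * c ∈ pauliSpan := by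
    induction ha using StarAlgebra.adjoin_induction with
    | mem a h =>
      obtain ⟨b, -, m, rfl⟩ := h
      refine ⟨fun c hc => obs_mul_mem_pauliSpan b m hc, fun c hc => ?_⟩
      rw [← map_star]
      exact obs_mul_mem_pauliSpan b _ hc
    | algebraMap r =>
      simp only [Algebra.algebraMap_eq_smul_one, star_smul, star_one, smul_mul_assoc, one_mul]
      exact ⟨fun c hc => Submodule.smul_mem _ _ hc, fun c hc => Submodule.smul_mem _ _ hc⟩
    | add a b _ _ h h' =>
      simp only [star_add, add_mul]
      exact ⟨fun c hc => add_mem (h.1 c hc) (h'.1 c hc), fun c hc => add_mem (h.2 c hc) (h'.2 c hc)⟩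
    | mul a b _ _ h h' =>
      simp only [star_mul, mul_assoc]
      exact ⟨fun c hc => h.1 _ (h'.1 c hc), fun c hc => h'.2 _ (h.2 c hc)⟩
    | star a _ h =>
      rw [star_star]
      exact h.symm
  rw [← mul_one a]
  exact h.1 1 (Submodule.subset_span ⟨[], [], by simp⟩)

/-- A state is determined by its values on the checks, if these are `1` or `-1`. -/
theorem State.HasSigns.unique {ω ω' : State} {q : Pauli → Option Point} (h : ω.HasSigns q)
    (h' : ω'.HasSigns q) : ω = ω' := by
  have hspan : ∀ a ∈ pauliSpan, ω.toFunctional a = ω'.toFunctional a := fun a ha => by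
    induction ha using Submodule.span_induction with
    | mem a ha =>
      obtain ⟨l, l', rfl⟩ := ha
      exact h.eq_monomial h' l l'
    | zero => simp
    | add a b _ _ h h' => rw [map_add, map_add, h, h']
    | smul r a _ h => rw [map_smul, map_smul, h]
  have hcl : IsClosed {a | ω.toFunctional a = ω'.toFunctional a} :=
    isClosed_eq (map_continuous ω.toFunctional) (map_continuous ω'.toFunctional)
  have : ω.toFunctional = ω'.toFunctional := DFunLike.ext _ _ fun a =>
    closure_minimal (fun a ha => hspan a (localObs_le_pauliSpan ha)) hcl (mem_closure_localObs a)
  cases ω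
  cases ω'
  congr

/-! ### Moving excitations by local unitaries -/

/-- Conjugation with a unitary. -/
noncomputable abbrev conj (u : unitary QuasiLocal) : QuasiLocal →⋆ₐ[ℂ] QuasiLocal :=
  (Unitary.conjStarAlgAut ℂ QuasiLocal u : QuasiLocal →⋆ₐ[ℂ] QuasiLocal)

theorem twists_id : Twists (conj 1) 0 := fun P s => by simp

theorem Twists.conj_mul {u v : unitary QuasiLocal} {f g : Pauli → Point → ZMod 2}
    (h : Twists (conj u) f) (h' : Twists (conj v) g) : Twists (conj (u * v)) (f + g) := by
  have := h.comp h'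
  intro P s
  rw [← this P s]
  simp [mul_assoc]

/-- The signs of the checks of kind `P` that are flipped when an excitation moves from `o`
to `o'`. -/
def moveTwist (P : Pauli) (o o' : Option Point) (Q : Pauli) (t : Point) : ZMod 2 :=
  if Q = P then ind o t + ind o' t else 0

theorem moveTwist_self (P : Pauli) (o : Option Point) : moveTwist P o o = 0 := by
  ext Q t
  simp [moveTwist, zmod_two_add_self]

theorem moveTwist_comm (P : Pauli) (o o' : Option Point) :
    moveTwist P o o' = moveTwist P o' o := by
  ext Q t
  simp [moveTwist, add_comm]

theorem moveTwist_add (P : Pauli) (o o' o'' : Option Point) :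
    moveTwist P o o' + moveTwist P o' o'' = moveTwist P o o'' := by
  have h : ∀ a b c : ZMod 2, a + b + (b + c) = a + c := by decide
  ext Q t
  simp only [moveTwist, Pi.add_apply]
  split_ifs <;> simp [h]

/-- Two sites are equivalent if a local unitary moves an excitation from one to the other. -/
def moveSetoid (P : Pauli) : Setoid Point where
  r s s' := ∃ u : unitary QuasiLocal, Twists (conj u) (moveTwist P (some s) (some s'))
  iseqv := by
    refine ⟨fun s => ⟨1, ?_⟩, fun {s s'} ⟨u, hu⟩ => ⟨u, ?_⟩, fun {s s' s''} ⟨u, hu⟩ ⟨v, hv⟩ =>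
      ⟨u * v, ?_⟩⟩
    · rw [moveTwist_self]
      exact twists_id
    · rwa [moveTwist_comm]
    · rw [← moveTwist_add P _ (some s')]
      exact hu.conj_mul hv

/-- The unitary is one Pauli matrix of the dual kind at `b`; it anticommutes with precisely the two
checks of kind `P` that contain `b`. -/
theorem moveSetoid_sides (P : Pauli) (b : Bond) : moveSetoid P (sides P b).1 (sides P b).2 := by
  refine ⟨⟨pauli P.dual b, ?_⟩, fun Q s => ?_⟩
  · rw [Unitary.mem_iff, star_pauli, pauli_mul_self]
    exact ⟨rfl, rfl⟩
  · have h := twists_letter (P.dual, b) Q s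
    have e : letterTwist (P.dual, b) Q s =
        moveTwist P (some (sides P b).1) (some (sides P b).2) Q s := by
      rw [letterTwist, moveTwist]
      rcases P.eq_or_eq_dual Q with rfl | rfl
      · rw [if_pos rfl, if_pos rfl, par_cells_eq_ind]
      · simp [P.dual_ne]
    rw [← e, ← h]
    simp [star_pauli]

theorem moveSetoid_all (P : Pauli) (s s' : Point) : moveSetoid P s s' := by
  have h1 : ∀ i j : ℤ, moveSetoid P (i + 1, j) (i, j) := fun i j => by
    cases P
    · exact (moveSetoid .x).symm (moveSetoid_sides .x (.hor i j))
    · simpa [sides] using moveSetoid_sides .z (.ver (i + 1) j)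
  have h2 : ∀ i j : ℤ, moveSetoid P (i, j + 1) (i, j) := fun i j => by
    cases P
    · exact (moveSetoid .x).symm (moveSetoid_sides .x (.ver i j))
    · simpa [sides] using moveSetoid_sides .z (.hor i (j + 1))
  -- In the quotient, moves between neighbours become equalities of consecutive values along a
  -- column and then along a row, so the classes are constant.
  refine Quotient.exact (s := moveSetoid P) (Eq.trans (b := ⟦(s.1, s'.2)⟧) ?_ ?_)
  · exact eq_of_forall_add_one (g := fun j => (⟦(s.1, j)⟧ : Quotient (moveSetoid P)))
      (fun j => Quotient.sound (h2 s.1 j)) s.2 s'.2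
  · exact eq_of_forall_add_one (g := fun i => (⟦(i, s'.2)⟧ : Quotient (moveSetoid P)))
      (fun i => Quotient.sound (h1 i s'.2)) s.1 s'.1

theorem exists_move (P : Pauli) {o o' : Option Point} (h : o.isSome = o'.isSome) :
    ∃ u : unitary QuasiLocal, Twists (conj u) (moveTwist P o o') := by
  cases o with
  | none =>
    cases o' with
    | none =>
      rw [moveTwist_self]
      exact ⟨1, twists_id⟩
    | some s' => simp at h
  | some s =>
    cases o' with
    | none => simp at h
    | some s' => exact moveSetoid_all P s s'

theorem moveTwist_x_add_z (q q' : Pauli → Option Point) :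
    moveTwist .x (q .x) (q' .x) + moveTwist .z (q .z) (q' .z) =
      fun P s => ind (q P) s + ind (q' P) s := by
  ext P s
  cases P <;> simp [moveTwist]

/-- Move the stars and the plaquettes separately. Conjugation by the product of the two unitaries
turns `ω` into a state with the signs `q'`, which is `ω'` by uniqueness. -/
theorem State.HasSigns.equivalent {ω ω' : State} {q q' : Pauli → Option Point}
    (h : ω.HasSigns q) (h' : ω'.HasSigns q') (hq : ∀ P, (q P).isSome = (q' P).isSome) :
    ω.Equivalent ω' := by
  obtain ⟨u, hu⟩ := exists_move .x (hq .x)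
  obtain ⟨v, hv⟩ := exists_move .z (hq .z)
  have huv := hu.conj_mul hv
  rw [moveTwist_x_add_z] at huv
  rw [← (Twists.hasSigns h huv).unique h']
  exact State.EquivOn.symm (ω.equivalent_comp_conj (u * v))

/-! ### The total charge as an invariant of the representation -/

/-- The product of the checks in a finite set. -/
noncomputable def block (P : Pauli) (S : Finset Point) : QuasiLocal :=
  prodL P (S.toList.flatMap (cells P))

/-- A bond with both sides in `S` occurs in exactly two of the cells, so it cancels: up to
cancellation, `block` lives only on the boundary of `S`. -/
theorem par_block (P : Pauli) {S : Finset Point} {b : Bond} (h1 : (sides P b).1 ∈ S)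
    (h2 : (sides P b).2 ∈ S) : par (S.toList.flatMap (cells P)) b = 0 := by
  rw [par_flatMap, Finset.sum_map_toList]
  simp only [par_cells_eq_ind, ind, Option.some.injEq, Finset.sum_add_distrib, Finset.sum_ite_eq,
    if_pos h1, if_pos h2]
  decide

theorem commute_block_pauli (P Q : Pauli) {S : Finset Point} {b : Bond} (h1 : (sides P b).1 ∈ S)
    (h2 : (sides P b).2 ∈ S) : Commute (block P S) (pauli Q b) := by
  rw [block, ← prodL_singleton]
  rcases P.eq_or_eq_dual Q with rfl | rfl
  · exact commute_prodL _ _ _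
  · have := prodL_mul_dual P (S.toList.flatMap (cells P)) [b]
    rwa [pairing_comm, pairing_singleton_left, par_block P h1 h2, chi_zero, one_smul] at this

theorem eventually_commute_block (P : Pauli) {a : QuasiLocal} (ha : a ∈ localObs Set.univ) :
    ∀ᶠ S in atTop, Commute (block P S) a := by
  induction ha using StarAlgebra.adjoin_induction with
  | mem a h =>
    obtain ⟨b, -, m, rfl⟩ := h
    filter_upwards [eventually_ge_atTop {(sides P b).1, (sides P b).2}] with S hS
    have h1 : (sides P b).1 ∈ S := hS (by simp)
    have h2 : (sides P b).2 ∈ S := hS (by simp)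
    have hx := commute_block_pauli P .x h1 h2
    have hz := commute_block_pauli P .z h1 h2
    rw [obs_eq]
    exact ((((Commute.one_right _).smul_right _).add_right (hx.smul_right _)).add_right
      (hz.smul_right _)).add_right ((hx.mul_right hz).smul_right _)
  | algebraMap r => exact Eventually.of_forall fun n => (Algebra.commutes r _).symm
  | add a b _ _ h h' => filter_upwards [h, h'] with n hn hn' using hn.add_right hn'
  | mul a b _ _ h h' => filter_upwards [h, h'] with n hn hn' using hn.mul_right hn'
  | star a _ h =>
    filter_upwards [h] with n hn
    have := hn.star_star
    rwa [block, star_prodL] at this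

/-- The total charge is the value of the product of the checks in a large finite set. -/
theorem State.HasSigns.eventually_block {ω : State} {q : Pauli → Option Point}
    (h : ω.HasSigns q) (P : Pauli) :
    ∀ᶠ S in atTop, ω.toFunctional (block P S) = chi (if (q P).isSome then 1 else 0) := by
  have hval : ∀ S, ω.toFunctional (block P S) = chi (∑ s ∈ S, ind (q P) s) := fun S => by
    rw [← Finset.sum_map_toList, chi_sum, List.map_map]
    have := h.mul_prodL P S.toList 1
    rw [one_mul, ω.map_one, mul_one] at this
    exact this
  simp only [hval]
  cases hq : q P with
  | none => exact Eventually.of_forall fun S => by simp [ind]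
  | some s =>
    filter_upwards [eventually_ge_atTop {s}] with S hS
    have hs : s ∈ S := hS (by simp)
    simp [ind, Finset.sum_ite_eq, hs]

/-- Transport the vector of `ω` to the space of `ω'` and approximate it there by `η = π(a)Ω'` with
`a` local. A large block `W` multiplies the former by the charge sign of `ω`. It commutes with `a`,
so it multiplies `η` by that of `ω'`. With opposite signs the unitary `π(W)` maps the sum of the two
vectors to a multiple of modulus one of their difference. Hence both have norm less than `1`,
although they add up to twice a unit vector. -/
theorem State.HasSigns.isSome_eq {ω ω' : State} {q q' : Pauli → Option Point}
    (h : ω.HasSigns q) (h' : ω'.HasSigns q') (he : ω.Equivalent ω') (P : Pauli) :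
    (q P).isSome = (q' P).isSome := by
  by_contra hne
  obtain ⟨U, hU⟩ := he
  obtain ⟨a, ha, hUa⟩ := ω'.exists_local_near (U ω.vec) one_pos
  obtain ⟨S, hS, h1, h2⟩ := ((eventually_commute_block P ha).and
    ((h.eventually_block P).and (h'.eventually_block P))).exists
  have hW : star (block P S) * block P S = 1 := by rw [block, star_prodL, prodL_mul_self]
  have hchi : ∀ c : ZMod 2, star (chi c) * chi c = 1 := fun c => by rw [star_chi, chi_mul_self]
  have e1 := hU (block P S) trivial ω.vec
  rw [ω.gns_vec_of_eq hW (hchi _) h1, map_smul] at e1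
  have e2 := ω'.gns_vec_of_eq hW (hchi _) h2
  set π := ω'.toFunctional.gnsStarAlgHom with hπ
  set η := π a ω'.vec with hη
  have e3 : π (block P S) η = chi (if (q' P).isSome then 1 else 0) • η := by
    rw [hη, ← mul_apply_eq_comp, ← map_mul, hS.eq, map_mul, mul_apply_eq_comp, e2, map_smul]
  have hneg : chi (if (q P).isSome then 1 else 0) = -chi (if (q' P).isSome then 1 else 0) := by
    generalize (q P).isSome = x at hne
    generalize (q' P).isSome = y at hne
    cases x <;> cases y <;> simp at hne ⊢
  have hnorm : ∀ ζ, ‖π (block P S) ζ‖ = ‖ζ‖ := fun ζ => by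
    refine ContinuousLinearMap.norm_map_of_mem_unitary ?_ ζ
    refine Unitary.map_mem π (Unitary.mem_iff.mpr ⟨hW, ?_⟩)
    rw [block, star_prodL, prodL_mul_self]
  have e4 : π (block P S) (U ω.vec + η) = chi (if (q P).isSome then 1 else 0) • (U ω.vec - η) := by
    rw [map_add, ← e1, e3, smul_sub, hneg, neg_smul, neg_smul, sub_neg_eq_add]
  have e5 := hnorm (U ω.vec + η)
  have hc1 : ∀ c : ZMod 2, ‖chi c‖ = 1 := fun c => by
    rcases zmod_two_cases c with rfl | rfl <;> simp
  rw [e4, norm_smul, hc1, one_mul] at e5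
  have h4 : ‖(U ω.vec - η) + (U ω.vec + η)‖ = 2 := by
    rw [sub_add_add_cancel, ← two_smul ℂ, norm_smul, LinearIsometryEquiv.norm_map, ω.norm_vec]
    simp
  have := norm_add_le (U ω.vec - η) (U ω.vec + η)
  rw [h4, ← e5] at this
  linarith

/-! ### String endomorphisms as localised automorphisms -/

/-- The adjoint reverses the word, and any two letters commute up to a sign, so restoring the order
costs one overall sign. -/
theorem exists_star_stringOp (w : ℕ → Pauli × Bond) (n : ℕ) :
    ∃ c : ZMod 2, star (stringOp w n) = chi c • stringOp w n := by
  have hcomm : ∀ n (P : Pauli) (b : Bond), ∃ c : ZMod 2,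
      pauli P b * stringOp w n = chi c • (stringOp w n * pauli P b) := by
    intro n P b
    induction n with
    | zero => exact ⟨0, by simp [stringOp]⟩
    | succ n ih =>
      obtain ⟨c, hc⟩ := ih
      obtain ⟨c', hc'⟩ : ∃ c' : ZMod 2, pauli P b * pauli (w n).1 (w n).2 =
          chi c' • (pauli (w n).1 (w n).2 * pauli P b) := by
        rcases P.eq_or_eq_dual (w n).1 with h | h
        · exact ⟨0, by rw [h, (commute_pauli P _ _).eq, chi_zero, one_smul]⟩
        · exact ⟨_, by rw [h, ← prodL_singleton P, ← prodL_singleton, prodL_mul_dual]⟩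
      refine ⟨c + c', ?_⟩
      rw [stringOp, ← mul_assoc, hc, smul_mul_assoc, mul_assoc, hc', mul_smul_comm, smul_smul,
        chi_add, mul_assoc]
  induction n with
  | zero => exact ⟨0, by simp [stringOp]⟩
  | succ n ih =>
    obtain ⟨c, hc⟩ := ih
    obtain ⟨c', hc'⟩ := hcomm n (w n).1 (w n).2
    exact ⟨c + c', by
      rw [stringOp, star_mul, star_pauli, hc, mul_smul_comm, hc', smul_smul, chi_add]⟩

/-- The string operator is unitary and self-adjoint up to a sign, so its square is a sign and
conjugation by it is an involution. -/
theorem adString_adString (w : ℕ → Pauli × Bond) (n : ℕ) (a : QuasiLocal) :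
    adString w n (adString w n a) = a := by
  obtain ⟨c, hc⟩ := exists_star_stringOp w n
  have h1 := Unitary.star_mul_self_of_mem (stringOp_mem_unitary w n)
  have h2 := Unitary.mul_star_self_of_mem (stringOp_mem_unitary w n)
  rw [hc] at h1 h2
  rw [smul_mul_assoc] at h1
  rw [mul_smul_comm] at h2
  simp only [adString, hc, mul_smul_comm, smul_mul_assoc]
  calc _ = (chi c • (stringOp w n * stringOp w n)) * a *
        (chi c • (stringOp w n * stringOp w n)) := by
        simp only [mul_assoc, mul_smul_comm, smul_mul_assoc]
    _ = a := by rw [h1, one_mul, mul_one]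

/-- The limit of these involutions is its own inverse: each is isometric, so applying it to the
difference of its value at `a` and the limit turns convergence of the values at `a` into convergence
back to `a`. -/
theorem stringEndo_surjective {w : ℕ → Pauli × Bond} (hw : LocallyFinite w) :
    Function.Surjective (stringEndo w hw) := by
  intro a
  refine ⟨limString w a, tendsto_nhds_unique (tendsto_limString hw (limString w a)) ?_⟩
  rw [tendsto_iff_norm_sub_tendsto_zero]
  have h := tendsto_iff_norm_sub_tendsto_zero.mp (tendsto_limString hw a)
  refine h.congr fun n => ?_
  rw [← norm_adString w n (adString w n a - limString w a), adString_sub, adString_adString,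
    norm_sub_rev]

theorem stringEndo_eq_self {w : ℕ → Pauli × Bond} (hw : LocallyFinite w) {Λ : Set Bond}
    (hΛ : ∀ n, (w n).2 ∈ Λ) {a : QuasiLocal} (ha : a ∈ observables Λᶜ) :
    stringEndo w hw a = a := by
  have hloc : ∀ a ∈ localObs Λᶜ, stringEndo w hw a = a := fun a ha => by
    have hcomm : ∀ n, Commute (pauli (w n).1 (w n).2) a := fun n => by
      induction ha using StarAlgebra.adjoin_induction with
      | mem a h =>
        obtain ⟨b, hb, m, rfl⟩ := h
        exact commute_obs (fun h => hb (by rw [← h]; exact hΛ n)) _ _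
      | algebraMap r => exact (Algebra.commutes r _).symm
      | add a b _ _ h h' => exact h.add_right h'
      | mul a b _ _ h h' => exact h.mul_right h'
      | star a _ h =>
        have := h.star_star
        rwa [star_pauli] at this
    refine tendsto_nhds_unique (tendsto_limString hw a) (tendsto_const_nhds.congr fun n => ?_)
    induction n with
    | zero => simp [adString, stringOp]
    | succ n ih => rw [adString_succ w n (hcomm n), ← ih]
  refine closure_minimal (s := (localObs Λᶜ : Set QuasiLocal))
    (t := {a | stringEndo w hw a = a}) hloc ?_ ?_
  · exact isClosed_eq (map_continuous _) continuous_id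
  · rw [← StarSubalgebra.topologicalClosure_coe]
    exact ha

/-! ### Lattice paths inside a cone -/

/-- Neighbouring points of `ℤ²`. -/
def Adj (p p' : Point) : Prop :=
  ((p'.1 = p.1 + 1 ∨ p'.1 = p.1 - 1) ∧ p'.2 = p.2) ∨
    (p'.1 = p.1 ∧ (p'.2 = p.2 + 1 ∨ p'.2 = p.2 - 1))

theorem MeetIn.symm {l l' : List Bond} {b : Bond} (h : MeetIn l l' b) : MeetIn l' l b :=
  fun b' => and_comm.trans (h b')

theorem meetIn_right (P : Pauli) (i j : ℤ) : ∃ b, MeetIn (cells P (i, j)) (cells P (i + 1, j)) b := by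
  cases P
  · exact ⟨_, meetIn_star i j⟩
  · exact ⟨_, meetIn_plaq i j⟩

theorem meetIn_up (P : Pauli) (i j : ℤ) : ∃ b, MeetIn (cells P (i, j)) (cells P (i, j + 1)) b := by
  cases P
  · refine ⟨.ver i j, fun b => ?_⟩
    cases b <;> simp only [cells, starBonds, List.mem_cons, Bond.hor.injEq, Bond.ver.injEq,
      reduceCtorEq, List.not_mem_nil, or_false, false_or, iff_false] <;> omega
  · refine ⟨.hor i (j + 1), fun b => ?_⟩
    cases b <;> simp only [cells, plaqBonds, List.mem_cons, Bond.hor.injEq, Bond.ver.injEq,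
      reduceCtorEq, List.not_mem_nil, or_false, false_or, iff_false] <;> omega

theorem Adj.exists_meetIn {p p' : Point} (h : Adj p p') (P : Pauli) :
    ∃ b, MeetIn (cells P p) (cells P p') b := by
  obtain ⟨i, j⟩ := p
  obtain ⟨i', j'⟩ := p'
  rcases h with ⟨h1 | h1, h2⟩ | ⟨h1, h2 | h2⟩ <;> dsimp only at h1 h2 <;> rw [h1, h2]
  · exact meetIn_right P i j
  · obtain ⟨b, hb⟩ := meetIn_right P (i - 1) j
    rw [sub_add_cancel] at hb
    exact ⟨b, hb.symm⟩
  · exact meetIn_up P i j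
  · obtain ⟨b, hb⟩ := meetIn_up P i (j - 1)
    rw [sub_add_cancel] at hb
    exact ⟨b, hb.symm⟩

/-- The bonds of a star or plaquette are near its label. -/
theorem abs_sub_le_of_mem_seg {P : Pauli} {p : Point} {b : Bond} (hb : b ∈ cells P p)
    {y : ℝ × ℝ} (hy : y ∈ b.seg) : |y.1 - p.1| ≤ 2 ∧ |y.2 - p.2| ≤ 2 := by
  obtain ⟨a, c, h1, h2⟩ : ∃ a c : ℤ, ((a : ℝ) ≤ y.1 ∧ y.1 ≤ a + 1 ∧ (c : ℝ) ≤ y.2 ∧ y.2 ≤ c + 1) ∧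
      p.1 - 1 ≤ a ∧ a ≤ p.1 + 1 ∧ p.2 - 1 ≤ c ∧ c ≤ p.2 + 1 := by
    cases b with
    | hor a c =>
      obtain ⟨s, t, hs, ht, hst, rfl⟩ := hy
      refine ⟨a, c, ?_, ?_⟩
      · simp only [toPlane, Prod.smul_mk, Prod.mk_add_mk, smul_eq_mul]
        push_cast
        have e1 : s * (a : ℝ) + t * (a + 1) = a + t := by linear_combination (a : ℝ) * hst
        have e2 : s * (c : ℝ) + t * c = c := by linear_combination (c : ℝ) * hst
        rw [e1, e2]
        refine ⟨?_, ?_, ?_, ?_⟩ <;> linarith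
      · cases P <;> simp only [cells, starBonds, plaqBonds, List.mem_cons, Bond.hor.injEq,
          reduceCtorEq, List.not_mem_nil, or_false] at hb <;> omega
    | ver a c =>
      obtain ⟨s, t, hs, ht, hst, rfl⟩ := hy
      refine ⟨a, c, ?_, ?_⟩
      · simp only [toPlane, Prod.smul_mk, Prod.mk_add_mk, smul_eq_mul]
        push_cast
        have e1 : s * (c : ℝ) + t * (c + 1) = c + t := by linear_combination (c : ℝ) * hst
        have e2 : s * (a : ℝ) + t * a = a := by linear_combination (a : ℝ) * hst
        rw [e1, e2]
        refine ⟨?_, ?_, ?_, ?_⟩ <;> linarith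
      · cases P <;> simp only [cells, starBonds, plaqBonds, List.mem_cons, Bond.ver.injEq,
          reduceCtorEq, List.not_mem_nil, or_false, false_or] at hb <;> omega
  have h3 : (p.1 : ℝ) - 1 ≤ a := by exact_mod_cast h2.1
  have h4 : (a : ℝ) ≤ p.1 + 1 := by exact_mod_cast h2.2.1
  have h5 : (p.2 : ℝ) - 1 ≤ c := by exact_mod_cast h2.2.2.1
  have h6 : (c : ℝ) ≤ p.2 + 1 := by exact_mod_cast h2.2.2.2
  rw [abs_le, abs_le]
  refine ⟨⟨?_, ?_⟩, ?_, ?_⟩ <;> linarith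

/-- The wedge contains balls of any radius along a half-line. -/
theorem exists_direction {o u w : ℝ × ℝ} (h : LinearIndependent ℝ ![u, w]) (R : ℝ) :
    ∃ d : ℝ × ℝ, |d.1| + |d.2| = 1 ∧ ∃ M : ℝ, ∀ m ≥ M, ∀ y : ℝ × ℝ,
      |y.1 - (o.1 + m * d.1)| ≤ R → |y.2 - (o.2 + m * d.2)| ≤ R → y ∈ wedge o u w := by
  rw [LinearIndependent.pair_iff] at h
  have hD : u.1 * w.2 - u.2 * w.1 ≠ 0 := by
    intro hD
    have h1 := h w.2 (-u.2) (Prod.ext (by simp; linarith) (by simp; ring))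
    have h2 := h w.1 (-u.1) (Prod.ext (by simp; ring) (by simp; linarith))
    have h3 := h 1 0 (Prod.ext (by simp; linarith [h2.2]) (by simp; linarith [h1.2]))
    exact one_ne_zero h3.1
  set D := u.1 * w.2 - u.2 * w.1
  set N := |u.1 + w.1| + |u.2 + w.2| with hN
  have hN0 : 0 < N := by
    refine lt_of_le_of_ne (by positivity) fun h0 => ?_
    have h1 : u.1 + w.1 = 0 := abs_eq_zero.mp (by
      linarith [abs_nonneg (u.1 + w.1), abs_nonneg (u.2 + w.2)])
    have h2 : u.2 + w.2 = 0 := abs_eq_zero.mp (by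
      linarith [abs_nonneg (u.1 + w.1), abs_nonneg (u.2 + w.2)])
    exact one_ne_zero (h 1 1 (Prod.ext (by simpa using h1) (by simpa using h2))).1
  -- The direction `u + w` points into the interior of the wedge. It is normalised in the `ℓ¹` norm,
  -- so that a lattice path with one unit step per unit of `m` can follow it.
  refine ⟨((u.1 + w.1) / N, (u.2 + w.2) / N), ?_, ?_⟩
  · simp only [abs_div, abs_of_pos hN0]
    rw [← add_div, ← hN, div_self hN0.ne']
  set K := |u.1| + |u.2| + |w.1| + |w.2| with hK
  -- By Cramer's rule the coefficients of `y - o` with respect to `u` and `w` are `m / N` plus a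
  -- correction of size at most `R * K / |D|`, caused by the displacement `(a, b)`. Beyond this
  -- bound on `m` both are nonnegative.
  refine ⟨N * (R * K / |D|), fun m hm y h1 h2 => ?_⟩
  have hR : 0 ≤ R := (abs_nonneg _).trans h1
  set a := y.1 - (o.1 + m * ((u.1 + w.1) / N)) with ha
  set b := y.2 - (o.2 + m * ((u.2 + w.2) / N)) with hb
  have hD0 : 0 < |D| := abs_pos.mpr hD
  have hmN : R * K / |D| ≤ m / N := by
    rw [le_div_iff₀ hN0, mul_comm]
    exact hm
  have key : ∀ v v' : ℝ, |v| + |v'| ≤ K → 0 ≤ m / N + (a * v + b * v') / D := by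
    intro v v' hv
    have : |(a * v + b * v') / D| ≤ R * K / |D| := by
      rw [abs_div]
      gcongr
      calc |a * v + b * v'| ≤ |a| * |v| + |b| * |v'| := by
            rw [← abs_mul, ← abs_mul]; exact abs_add_le _ _
        _ ≤ R * |v| + R * |v'| := by gcongr
        _ = R * (|v| + |v'|) := by ring
        _ ≤ R * K := by gcongr
    linarith [neg_abs_le ((a * v + b * v') / D)]
  refine ⟨_, _, key w.2 (-w.1) ?_, key (-u.2) u.1 ?_, ?_⟩
  · rw [abs_neg]
    linarith [abs_nonneg u.1, abs_nonneg u.2]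
  · rw [abs_neg]
    linarith [abs_nonneg w.1, abs_nonneg w.2]
  · have e1 : (a * w.2 + b * -w.1) * u.1 + (a * -u.2 + b * u.1) * w.1 = a * D := by ring
    have e2 : (a * w.2 + b * -w.1) * u.2 + (a * -u.2 + b * u.1) * w.2 = b * D := by ring
    refine Prod.ext ?_ ?_
    · simp only [Prod.fst_add, Prod.smul_fst, smul_eq_mul]
      have : y.1 = o.1 + m * ((u.1 + w.1) / N) + a * D / D := by
        rw [mul_div_cancel_right₀ _ hD, ha]; ring
      rw [this, ← e1]
      ring
    · simp only [Prod.snd_add, Prod.smul_snd, smul_eq_mul]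
      have : y.2 = o.2 + m * ((u.2 + w.2) / N) + b * D / D := by
        rw [mul_div_cancel_right₀ _ hD, hb]; ring
      rw [this, ← e2]
      ring

theorem exists_sign (x : ℝ) : ∃ σ : ℤ, (σ = 1 ∨ σ = -1) ∧ (σ : ℝ) * |x| = x := by
  rcases abs_choice x with h | h
  · exact ⟨1, Or.inl rfl, by rw [h]; simp⟩
  · exact ⟨-1, Or.inr rfl, by rw [h]; simp⟩

/-- Every half-line is accompanied by a lattice path. -/
theorem exists_lattice_path (o : Point) {d : ℝ × ℝ} (hd : |d.1| + |d.2| = 1) :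
    ∃ f : ℕ → Point, Function.Injective f ∧ (∀ m, Adj (f m) (f (m + 1))) ∧
      ∀ m : ℕ, |((f m).1 : ℝ) - (o.1 + m * d.1)| ≤ 1 ∧ |((f m).2 : ℝ) - (o.2 + m * d.2)| ≤ 1 := by
  obtain ⟨σ, hσ, hσd⟩ := exists_sign d.1
  obtain ⟨τ, hτ, hτd⟩ := exists_sign d.2
  -- Of the first `m` steps, `k m` are horizontal and `m - k m` vertical. As `|d.1| ≤ 1`, `k` grows
  -- by `0` or `1`, so each step changes one coordinate. As `|d.2| = 1 - |d.1|`, the rounding error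
  -- in both coordinates is the same up to sign. The `ℓ¹` distance from the start is `m`, which
  -- gives injectivity.
  let k : ℕ → ℤ := fun m => ⌊(m : ℝ) * |d.1|⌋
  have hk : ∀ m : ℕ, k (m + 1) = k m ∨ k (m + 1) = k m + 1 := by
    intro m
    have h1 : k m ≤ k (m + 1) := Int.floor_le_floor (by
      push_cast
      nlinarith [abs_nonneg d.1])
    have h2 : k (m + 1) ≤ k m + 1 := by
      rw [← Int.floor_add_one]
      refine Int.floor_le_floor ?_
      push_cast
      nlinarith [abs_nonneg d.2]
    omega
  have hb1 : ∀ m : ℕ, (k m : ℝ) ≤ m * |d.1| := fun m => Int.floor_le _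
  have hb2 : ∀ m : ℕ, (m : ℝ) * |d.1| < k m + 1 := fun m => Int.lt_floor_add_one _
  refine ⟨fun m => (o.1 + σ * k m, o.2 + τ * (m - k m)), fun m n hmn => ?_, fun m => ?_,
    fun m => ⟨?_, ?_⟩⟩
  · have h1 := congrArg Prod.fst hmn
    have h2 := congrArg Prod.snd hmn
    dsimp only at h1 h2
    rcases hσ with rfl | rfl <;> rcases hτ with rfl | rfl <;> omega
  · simp only [Adj]
    push_cast
    rcases hσ with rfl | rfl <;> rcases hτ with rfl | rfl <;> rcases hk m with h | h <;>
      rw [h] <;> omega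
  · have : ((o.1 + σ * k m : ℤ) : ℝ) - (o.1 + m * d.1) = σ * (k m - m * |d.1|) := by
      push_cast
      linear_combination (m : ℝ) * hσd
    have hσ1 : |(σ : ℝ)| = 1 := by rcases hσ with rfl | rfl <;> simp
    rw [this, abs_mul, hσ1, one_mul, abs_le]
    constructor <;> linarith [hb1 m, hb2 m]
  · have : ((o.2 + τ * (m - k m) : ℤ) : ℝ) - (o.2 + m * d.2) = τ * (m * |d.1| - k m) := by
      push_cast
      linear_combination (m : ℝ) * hτd - (m : ℝ) * τ * hd
    have hτ1 : |(τ : ℝ)| = 1 := by rcases hτ with rfl | rfl <;> simp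
    rw [this, abs_mul, hτ1, one_mul, abs_le]
    constructor <;> linarith [hb1 m, hb2 m]

/-- A cone contains a path to infinity together with all adjacent bonds. -/
theorem IsCone.exists_path {Λ : Set Bond} (hΛ : IsCone Λ) :
    ∃ f : ℕ → Point, Function.Injective f ∧ (∀ m, Adj (f m) (f (m + 1))) ∧
      ∀ m P, ∀ b ∈ cells P (f m), b ∈ Λ := by
  obtain ⟨o, u, w, hind, rfl⟩ := hΛ
  -- The radius `3` is `2`, for the distance of a bond from the label of its cell, plus `1`, for the
  -- distance of the path from the half-line, in each coordinate.
  obtain ⟨d, hd, M, hM⟩ := exists_direction (o := toPlane o) hind 3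
  obtain ⟨f, hinj, hadj, hf⟩ := exists_lattice_path o hd
  obtain ⟨N, hN⟩ := exists_nat_ge M
  refine ⟨fun m => f (m + N), fun m n h => Nat.add_right_cancel (hinj h),
    fun m => by simpa only [add_right_comm] using hadj (m + N), fun m P b hb => Or.inl fun y hy => ?_⟩
  obtain ⟨h1, h2⟩ := abs_sub_le_of_mem_seg hb hy
  obtain ⟨h3, h4⟩ := hf (m + N)
  refine hM (m + N : ℕ) (by push_cast; linarith [(Nat.cast_nonneg m : (0 : ℝ) ≤ m)]) y ?_ ?_
  · refine (abs_sub_le _ _ _).trans (add_le_add h1 h3 |>.trans (by norm_num))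
  · refine (abs_sub_le _ _ _).trans (add_le_add h2 h4 |>.trans (by norm_num))

/-! ### Creating charges inside a cone -/

/-- Excitations can be created by endomorphisms localised in a cone. -/
theorem IsCone.exists_endo {Λ : Set Bond} (hΛ : IsCone Λ) (P : Pauli) (c : Bool) :
    ∃ α : QuasiLocal →⋆ₐ[ℂ] QuasiLocal, Function.Surjective α ∧ (∀ a ∈ observables Λᶜ, α a = a) ∧
      ∃ o : Option Point, o.isSome = c ∧ Twists α (moveTwist P none o) := by
  cases c with
  | false =>
    refine ⟨StarAlgHom.id ℂ _, Function.surjective_id, fun _ _ => rfl, none, rfl, ?_⟩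
    rw [moveTwist_self]
    intro P s
    simp
  | true =>
    obtain ⟨f, hinj, hadj, hf⟩ := hΛ.exists_path
    choose b hb using fun m => (hadj m).exists_meetIn P
    have hbΛ : ∀ m, b m ∈ Λ := fun m => hf m P _ ((hb m _).mpr rfl).1
    have hlim : Tendsto f atTop cofinite := by
      rw [← Nat.cofinite_eq_atTop]
      exact hinj.tendsto_cofinite
    cases P with
    | x =>
      -- Stars are flipped by strings of σᶻ, so the checks of kind `x` call for a path of type `Z`,
      -- and those of kind `z` for one of type `X`.
      let γ : InfinitePath .Z (f 0) := ⟨f, fun n => (.z, b n), rfl, fun n => ⟨rfl, hb n⟩, hlim⟩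
      refine ⟨γ.endo, stringEndo_surjective _, fun a ha => stringEndo_eq_self _ hbΛ ha,
        some (f 0), rfl, ?_⟩
      convert γ.twists_endo using 3 with P s
      cases P <;> simp [moveTwist, charge, ind]
    | z =>
      let γ : InfinitePath .X (f 0) := ⟨f, fun n => (.x, b n), rfl, fun n => ⟨rfl, hb n⟩, hlim⟩
      refine ⟨γ.endo, stringEndo_surjective _, fun a ha => stringEndo_eq_self _ hbΛ ha,
        some (f 0), rfl, ?_⟩
      convert γ.twists_endo using 3 with P s
      cases P <;> simp [moveTwist, charge, ind]

/-- Composing the two automorphisms covers type `Y` without a ribbon inside the cone. The composite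
leaves the representation on `observables Λᶜ` unchanged up to equivalence. Its charges may sit at
other sites than those of `ω`, or far apart, but only their presence matters for the equivalence
with `ω`. -/
theorem State.HasSigns.equivOn_compl_cone {ω₀ ω : State} (h₀ : ω₀.HasSigns fun _ => none)
    {q : Pauli → Option Point} (h : ω.HasSigns q) {Λ : Set Bond} (hΛ : IsCone Λ) :
    State.EquivOn (observables Λᶜ) ω₀ ω := by
  obtain ⟨α, hα, hαΛ, o, ho, hαt⟩ := hΛ.exists_endo .x (q .x).isSome
  obtain ⟨β, hβ, hβΛ, o', ho', hβt⟩ := hΛ.exists_endo .z (q .z).isSome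
  let q' : Pauli → Option Point
    | .x => o
    | .z => o'
  have ht := hαt.comp hβt
  have e := moveTwist_x_add_z (fun _ => none) q'
  rw [e] at ht
  refine (State.equivOn_comp ω₀ (α.comp β) (hα.comp hβ) fun b hb => ?_).symm.trans
    (State.EquivOn.mono le_top ((Twists.hasSigns h₀ ht).equivalent h ?_))
  · rw [StarAlgHom.comp_apply, hβΛ b hb, hαΛ b hb]
  · rintro (_ | _)
    · exact ho
    · exact ho'

end ToricCode

theorem mainTheorem2 (ω₀ : ToricCode.State) (hω₀ : ω₀.IsGroundState) :
    (∀ Λ : Set ToricCode.Bond, ToricCode.IsCone Λ →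
      ∀ (k : ToricCode.Kind) (x : ToricCode.Site k) (γ : ToricCode.InfinitePath k x),
        ToricCode.State.EquivOn (ToricCode.observables Λᶜ) ω₀ (ω₀.excite γ)) ∧
    (∀ (k l : Option ToricCode.Kind) (ω ω' : ToricCode.State),
      ω₀.HasType k ω → ω₀.HasType l ω' → (ω.Equivalent ω' ↔ k = l)) := by
  have h₀ := hω₀.hasSigns
  refine ⟨fun Λ hΛ k x γ =>
    h₀.equivOn_compl_cone (ToricCode.State.hasSigns_excite h₀ γ) hΛ, fun k l ω ω' hω hω' => ?_⟩
  obtain ⟨q, hq, hqk⟩ := hω.exists_hasSigns h₀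
  obtain ⟨q', hq', hql⟩ := hω'.exists_hasSigns h₀
  constructor
  · intro h
    refine ToricCode.hasCharge_injective (funext fun P => ?_)
    rw [← hqk, ← hql, hq.isSome_eq hq' h]
  · rintro rfl
    exact hq.equivalent hq' fun P => (hqk P).trans (hql P).symm
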